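/- **Definitions.** Let $X$ be a nonempty set. A *game tree* on $X$ is a nonempty set $T\subseteq X^{<\mathbb N}$ of finite sequences (*positions*) closed under initial segments; $p\in T$ is *terminal* if it has no proper extension in $T$. Let $[T]$ be the set of infinite branches of $T$ and $\lceil T\rceil$ the set of *plays*, i.e. of terminal positions and infinite branches. For $p\in T$ let $T_p=\{q\in T: q\subseteq p\text{ or }p\subseteq q\}$. The sets $\lceil T_p\rceil$ ($p\in T$) form a basis of the topology of $\lceil T\rceil$, and $[T]$ has the subspace topology. A *game tree with taboos* is a triple $\mathbf T=\langle T,\mathcal T_{\mathrm I},\mathcal T_{\mathrm{II}}\rangle$, where $T$ is a game tree and the (possibly empty) sets $\mathcal T_{\mathrm I},\mathcal T_{\mathrm{II}}$ partition the set $\lceil T\rceil\setminus[T]$ of terminal positions; elements of $\mathcal T_P$ are called *taboo for* $P$. A *strategy* for player I (II) assigns to each nonterminal position $p$ of even (odd) length a move at $p$, i.e. some $a$ with $p^\frown\langle a\rangle\in T$. A position $p$ is *consistent* with a strategy $\sigma$ for I (II) if $p(i)=\sigma(p|_i)$ for all even (odd) $i<|p|$; a play $x$ is consistent with $\sigma$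 if all positions $p\subseteq x$ are. A *covering* of $\mathbf T$ is a triple $\langle\tilde{\mathbf T},\pi,\phi\rangle$ where $\tilde{\mathbf T}=\langle\tilde T,\tilde{\mathcal T}_{\mathrm I},\tilde{\mathcal T}_{\mathrm{II}}\rangle$ is a game tree with taboos (on some set $\tilde X$), and: * $\pi:\tilde T\to T$ satisfies, for all $\tilde p,\tilde q\in\tilde T$: $\tilde p\subseteq\tilde q\Rightarrow\pi(\tilde p)\subseteq\pi(\tilde q)$; $|\pi(\tilde p)|=|\tilde p|$; and $\pi(\tilde p)\in\mathcal T_P\Rightarrow\tilde p\in\tilde{\mathcal T}_P$ for $P\in\{\mathrm I,\mathrm{II}\}$. Such a $\pi$ induces a map $\pi:[\tilde T]\to[T]$, where $\pi(\tilde x)$ is the branch whose initial segments are the $\pi(\tilde x|_n)$. * $\phi$ maps the strategies for each player in $\tilde T$ to strategies for the same player in $T$, in such a way that for each $n\in\mathbb N$ the restriction of $\phi(\tilde\sigma)$ to positions of length $<n$ depends only on the restriction of $\tilde\sigma$ to positions of length $<n$. * (*lifting condition*) for every player $P$, every strategy $\tilde\sigma$ for $P$ in $\tilde T$ and every $x\in\lceil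 T\rceil$ consistent with $\phi(\tilde\sigma)$ there is $\tilde x\in\lceil\tilde T\rceil$ consistent with $\tilde\sigma$ such that $\pi(\tilde x)\subseteq x$ and, moreover, $\pi(\tilde x)=x$ or $\tilde x$ is taboo for $P$. For $k\in\mathbb N$ such a covering is a *$k$-covering* if, up to level $k$, the two trees are the same and $\pi$, $\phi$ are the identity; that is, if, after identifying $X$ with a subset of $\tilde X$, (a) $T$ and $\tilde T$ have the same positions of length $\le k$, and among these the same positions are taboo for I, respectively for II; (b) $\pi(\tilde p)=\tilde p$ whenever $|\tilde p|\le k$; (c) $\phi(\tilde\sigma)(p)=\tilde\sigma(p)$ for every strategy $\tilde\sigma$ in $\tilde T$ and every position $p$ of length $<k$ at which $\tilde\sigma$ is defined. The covering *unravels* $A\subseteq[T]$ if $\pi^{-1}(A)$ is clopen in $[\tilde T]$. **Theorem.** Let $\mathbf T$ be a game tree with taboos, let $k\in\mathbb N$, and let $A\subseteq[T]$ be Borel. Then there is a $k$-covering of $\mathbf T$ that unravels $A$. -/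

import Mathlib

universe u v

/-! ### Finite and infinite sequences -/

/-- The initial segment of length `n` of an infinite sequence. -/
def initSeg {X : Type u} (x : ℕ → X) (n : ℕ) : List X := (List.range n).map x

/-- Finite or infinite sequences in `X`. -/
inductive FinInfSeq (X : Type u) : Type u
  | fin (p : List X) : FinInfSeq X
  | inf (x : ℕ → X) : FinInfSeq X

/-- The finite sequence `p` is an initial segment of `s`. -/
def FinInfSeq.HasInit {X : Type u} (p : List X) : FinInfSeq X → Prop
  | .fin q => p <+: q
  | .inf x => p = initSeg x p.length

/-- `s ⊆ t`: the sequence `t` extends `s` (possibly `s = t`). -/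
def FinInfSeq.Sub {X : Type u} (s t : FinInfSeq X) : Prop :=
  ∀ p : List X, FinInfSeq.HasInit p s → FinInfSeq.HasInit p t

/-! ### Game trees -/

/-- A game tree on `X`: a nonempty set of finite sequences closed under initial segments. -/
structure GameTree (X : Type u) where
  positions : Set (List X)
  nonempty : positions.Nonempty
  closed : ∀ p q : List X, q ∈ positions → p <+: q → p ∈ positions

namespace GameTree

variable {X : Type u}

/-- The type of positions of `T`. -/
abbrev Pos (T : GameTree X) : Type u := {p : List X // p ∈ T.positions}

/-- A position is terminal if it has no proper extension in `T`. -/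
def Terminal (T : GameTree X) (p : List X) : Prop :=
  p ∈ T.positions ∧ ¬ ∃ q ∈ T.positions, p <+: q ∧ p ≠ q

/-- `a` is a move at `p`. -/
def IsMove (T : GameTree X) (p : List X) (a : X) : Prop := p ++ [a] ∈ T.positions

/-- The space `[T]` of infinite branches (infinite plays) of `T`. -/
def Branch (T : GameTree X) : Type u := {x : ℕ → X // ∀ n : ℕ, initSeg x n ∈ T.positions}

/-- `s` is a play of `T`: a terminal position or an infinite branch. -/
def IsPlay (T : GameTree X) : FinInfSeq X → Prop
  | .fin p => T.Terminal p
  | .inf x => ∀ n : ℕ, initSeg x n ∈ T.positions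

/-- The space `⌈T⌉` of all plays of `T`. -/
def Play (T : GameTree X) : Type u := {s : FinInfSeq X // T.IsPlay s}

/-- The game subtree `T_p` of the positions comparable with `p`. -/
def subtree (T : GameTree X) (p : List X) : GameTree X where
  positions := {q | q ∈ T.positions ∧ (q <+: p ∨ p <+: q)}
  nonempty := by
    obtain ⟨q, hq⟩ := T.nonempty
    exact ⟨[], T.closed [] q hq List.nil_prefix, Or.inl List.nil_prefix⟩
  closed := by
    rintro r q ⟨hq, h⟩ hrq
    refine ⟨T.closed r q hq hrq, ?_⟩
    rcases h with h | h
    · exact Or.inl (hrq.trans h)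
    · exact List.prefix_or_prefix_of_prefix hrq h

/-- The topology of `⌈T⌉`, with basic open sets `⌈T_p⌉` for `p ∈ T`. -/
instance (T : GameTree X) : TopologicalSpace T.Play :=
  TopologicalSpace.generateFrom
    {U | ∃ p ∈ T.positions, U = {s : T.Play | (T.subtree p).IsPlay s.1}}

/-- An infinite branch, as a play. -/
def Branch.toPlay {T : GameTree X} (x : T.Branch) : T.Play := ⟨.inf x.1, x.2⟩

/-- `[T]` carries the subspace topology of `⌈T⌉`. -/
instance (T : GameTree X) : TopologicalSpace T.Branch :=
  TopologicalSpace.induced Branch.toPlay inferInstance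

end GameTree

/-! ### Strategies -/

/-- The two players. -/
inductive Player : Type
  | I : Player
  | II : Player

/-- Player I moves at positions of even length, player II at positions of odd length. -/
def Player.Turn : Player → ℕ → Prop
  | .I, n => Even n
  | .II, n => Odd n

namespace GameTree

variable {X : Type u}

/-- The nonterminal positions at which player `P` has to move. -/
abbrev Decision (T : GameTree X) (P : Player) : Type u :=
  {p : List X // p ∈ T.positions ∧ ¬ T.Terminal p ∧ P.Turn p.length}

/-- A strategy for player `P` in `T`. Strategies for the two players form separate types, so that
every strategy is a strategy for exactly one player. -/
structure Strategy (T : GameTree X) (P : Player) where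
  move : T.Decision P → X
  legal : ∀ p : T.Decision P, T.IsMove p.1 (move p)

/-- The position `p` is consistent with `σ`: whenever an initial segment `q` of `p` is a position
where `P` has to move, the next entry of `p` is the move given by `σ` at `q`. -/
def Strategy.ConsistentPos {T : GameTree X} {P : Player} (σ : T.Strategy P) (p : T.Pos) : Prop :=
  ∀ (q : T.Decision P) (a : X), q.1 ++ [a] <+: p.1 → a = σ.move q

/-- A play is consistent with `σ` if all positions `p ⊆ x` are. -/
def Strategy.ConsistentPlay {T : GameTree X} {P : Player} (σ : T.Strategy P) (x : T.Play) : Prop :=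
  ∀ p : T.Pos, FinInfSeq.HasInit p.1 x.1 → σ.ConsistentPos p

end GameTree

/-! ### Game trees with taboos -/

/-- A game tree with taboos: the finite plays are divided into those taboo for player I and those
taboo for player II. -/
structure TabooTree (X : Type u) extends GameTree X where
  taboo : Player → Set (List X)
  taboo_disjoint : Disjoint (taboo Player.I) (taboo Player.II)
  taboo_union : taboo Player.I ∪ taboo Player.II = {p | toGameTree.Terminal p}

/-- The play `s` is taboo for player `P` (in particular it is finite). -/
def TabooTree.IsTabooFor {X : Type u} (T : TabooTree X) (P : Player) (s : T.Play) : Prop :=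
  ∃ p ∈ T.taboo P, s.1 = .fin p

/-! ### Position maps and their action on plays -/

/-- A position map from `T'` to `T`. -/
structure PositionMap {Y : Type v} {X : Type u} (T' : TabooTree Y) (T : TabooTree X) where
  toFun : T'.Pos → T.Pos
  mono : ∀ p q : T'.Pos, p.1 <+: q.1 → (toFun p).1 <+: (toFun q).1
  length_eq : ∀ p : T'.Pos, (toFun p).1.length = p.1.length
  taboo : ∀ (P : Player) (p : T'.Pos), (toFun p).1 ∈ T.taboo P → p.1 ∈ T'.taboo P

namespace PositionMap

variable {Y : Type v} {X : Type u} {T' : TabooTree Y} {T : TabooTree X}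

/-- The sequence in `X` whose `n`-th entry is the last entry of the image of the initial segment
of length `n + 1` of the branch `x`. -/
def branchSeq (f : PositionMap T' T) (x : T'.Branch) (n : ℕ) : X :=
  (f.toFun ⟨initSeg x.1 (n + 1), x.2 (n + 1)⟩).1[n]'(by
    rw [f.length_eq]; simp [initSeg])

theorem initSeg_branchSeq (f : PositionMap T' T) (x : T'.Branch) (n : ℕ) :
    initSeg (f.branchSeq x) n = (f.toFun ⟨initSeg x.1 n, x.2 n⟩).1 := by
  apply List.ext_getElem
  · rw [f.length_eq]; simp [initSeg]
  · intro i h1 h2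
    have hi : i < n := by simpa [initSeg] using h1
    have hpre : initSeg x.1 (i + 1) <+: initSeg x.1 n := by
      refine ⟨((List.range n).drop (i + 1)).map x.1, ?_⟩
      have h : List.range (i + 1) = (List.range n).take (i + 1) := by
        rw [List.take_range, min_eq_left (Nat.succ_le_of_lt hi)]
      rw [initSeg, initSeg, h, ← List.map_append, List.take_append_drop]
    have h := f.mono ⟨_, x.2 (i + 1)⟩ ⟨_, x.2 n⟩ hpre
    have hlen : i < (f.toFun ⟨initSeg x.1 (i + 1), x.2 (i + 1)⟩).1.length := by
      rw [f.length_eq]; simp [initSeg]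
    simpa [initSeg, branchSeq] using h.getElem hlen

/-- The map `[T'] → [T]` induced by a position map: the image of `x` is the branch whose initial
segments are the images of those of `x`. -/
def branchMap (f : PositionMap T' T) (x : T'.Branch) : T.Branch :=
  ⟨f.branchSeq x, fun n => by
    rw [f.initSeg_branchSeq x n]; exact (f.toFun _).2⟩

/-- The image of a play of `T'` under a position map; it need not be a play of `T`. -/
def playMap (f : PositionMap T' T) : T'.Play → FinInfSeq X
  | ⟨.fin p, hp⟩ => .fin (f.toFun ⟨p, hp.1⟩).1
  | ⟨.inf x, hx⟩ => .inf (f.branchMap ⟨x, hx⟩).1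

end PositionMap

/-! ### Coverings -/

/-- A covering of `T` by a game tree with taboos on `Y`. -/
structure TabooCovering {X : Type u} (T : TabooTree X) (Y : Type v) where
  tree : TabooTree Y
  posMap : PositionMap tree T
  stratMap : ∀ P : Player, tree.Strategy P → T.Strategy P
  /-- The restriction of the image of `σ` to positions of length `< n` depends only on that
  of `σ`. -/
  stratMap_local : ∀ (P : Player) (n : ℕ) (σ τ : tree.Strategy P),
    (∀ q : tree.Decision P, q.1.length < n → σ.move q = τ.move q) →
    ∀ p : T.Decision P, p.1.length < n → (stratMap P σ).move p = (stratMap P τ).move p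
  /-- The lifting condition. -/
  lifting : ∀ (P : Player) (σ : tree.Strategy P) (x : T.Play),
    (stratMap P σ).ConsistentPlay x →
    ∃ y : tree.Play, σ.ConsistentPlay y ∧ (posMap.playMap y).Sub x.1 ∧
      (posMap.playMap y = x.1 ∨ tree.IsTabooFor P y)

namespace TabooCovering

variable {X : Type u} {T : TabooTree X} {Y : Type v}

/-- `C` is a `k`-covering, where `X` is regarded as a subset of `Y` through the injection `ι`:
up to level `k` the two trees have the same positions and the same taboos, the position map is the
identity, and the strategy map does not change the moves number `1, …, k` (those made at positions
of length `< k`). -/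
structure IsKCovering (C : TabooCovering T Y) (ι : X ↪ Y) (k : ℕ) : Prop where
  positions_eq : {q | q ∈ C.tree.positions ∧ q.length ≤ k} =
    List.map ι '' {p | p ∈ T.positions ∧ p.length ≤ k}
  taboo_eq : ∀ P : Player, {q | q ∈ C.tree.taboo P ∧ q.length ≤ k} =
    List.map ι '' {p | p ∈ T.taboo P ∧ p.length ≤ k}
  posMap_eq : ∀ q : C.tree.Pos, q.1.length ≤ k → (C.posMap.toFun q).1.map ι = q.1
  stratMap_eq : ∀ (P : Player) (σ : C.tree.Strategy P) (q : C.tree.Decision P)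
    (p : T.Decision P), p.1.length < k → q.1 = p.1.map ι →
    ι ((C.stratMap P σ).move p) = σ.move q

/-- `C` unravels `A ⊆ [T]`: the preimage of `A` under `[T'] → [T]` is clopen. -/
def Unravels (C : TabooCovering T Y) (A : Set T.Branch) : Prop :=
  IsClopen (C.posMap.branchMap ⁻¹' A)

end TabooCovering

/-!
This is Martin's proof that every Borel set of branches can be unraveled. The argument is an
induction on Borel sets. The inductive statement is that, for every position map from a tree `S` to
`T` and every `k`, the preimage of `A` in `[S]` is unraveled by some `k`-covering of `S`
(`unravelable_of_measurableSet`).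

Open sets (`unravelable_of_isOpen`). Let `B` consist of the shortest nonterminal positions, of
length at least `k + 2`, all of whose extensions to branches lie in the open set. In the covering
tree the player who moves at level `k` also names a set `𝒳 ⊆ B`, thereby claiming to avoid `B \ 𝒳`.
The opponent, at level `k + 1`, either picks some `u ∈ 𝒳`, and then the play is forced through `u`,
or accepts, thereby claiming to avoid `𝒳`. In the second case the play stops on reaching `B`, and is
taboo for the player whose claim failed. An infinite play is thus in the preimage of the open set
exactly if some `u` was picked, which is decided at level `k + 1`. Given a strategy `σ` in the
covering tree, its image follows `σ` against acceptance until a position `u` is reached that can be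
picked in some play consistent with `σ`. Since all moves between level `k + 1` and `u` are forced
once `u` is picked, what has been played is then consistent with `σ` also under the pick of `u`, and
the image follows `σ` in that play from there on. If `σ` belongs to the opponent, the set `𝒳` used
is that of the positions `σ` cannot be made to pick, so `σ` has to accept it. No determinacy of an
auxiliary game is needed.

Complements are immediate. For a countable union (`Unravelable.iUnion`), the sets are unraveled one
after the other, by a `(k + n)`-covering at stage `n`. The inverse limit of these coverings
(`InverseLimit.cov`) is a `k`-covering of the first tree. The limit agrees with the `n`-th tree up
to level `k + n`, so a strategy in it can be carried down to every stage. All the sets have clopen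
preimages in the limit, so their union has an open preimage, to which the open case applies.
-/

universe w

/-! ### Finite and infinite sequences: basic facts -/

section Sequences

variable {X : Type u}

@[simp] theorem length_initSeg (x : ℕ → X) (n : ℕ) : (initSeg x n).length = n := by
  simp [initSeg]

theorem initSeg_succ (x : ℕ → X) (n : ℕ) : initSeg x (n + 1) = initSeg x n ++ [x n] := by
  simp [initSeg, List.range_succ]

theorem take_initSeg (x : ℕ → X) {m n : ℕ} (h : m ≤ n) :
    (initSeg x n).take m = initSeg x m := by
  simp [initSeg, ← List.map_take, List.take_range, h]

theorem initSeg_prefix (x : ℕ → X) {m n : ℕ} (h : m ≤ n) : initSeg x m <+: initSeg x n := by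
  rw [← take_initSeg x h]; exact List.take_prefix _ _

theorem initSeg_injective {x y : ℕ → X} (h : ∀ n, initSeg x n = initSeg y n) : x = y := by
  funext n
  have := h (n + 1)
  rw [initSeg_succ, initSeg_succ, h n] at this
  simpa using this

theorem eq_initSeg_of_prefix {x : ℕ → X} {p : List X} {n : ℕ} (h : p <+: initSeg x n) :
    p = initSeg x p.length := by
  have hl := h.length_le
  rw [length_initSeg] at hl
  rw [← take_initSeg x hl]
  exact List.prefix_iff_eq_take.1 h

theorem FinInfSeq.Sub.refl (s : FinInfSeq X) : s.Sub s := fun _ h => h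

theorem FinInfSeq.HasInit.of_prefix {s : FinInfSeq X} {p q : List X} (h : HasInit q s)
    (hp : p <+: q) : HasInit p s := by
  cases s with
  | fin r => exact hp.trans h
  | inf x =>
    change q = _ at h
    rw [h] at hp
    exact eq_initSeg_of_prefix hp

theorem FinInfSeq.HasInit.prefix_of_length_le {s : FinInfSeq X} {p q : List X}
    (hp : HasInit p s) (hq : HasInit q s) (h : p.length ≤ q.length) : p <+: q := by
  cases s with
  | fin r => exact List.prefix_of_prefix_length_le hp hq h
  | inf x =>
    change p = _ at hp
    change q = _ at hq
    rw [hp, hq]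
    exact initSeg_prefix x h

theorem FinInfSeq.fin_sub_iff {p : List X} {s : FinInfSeq X} :
    (FinInfSeq.fin p).Sub s ↔ HasInit p s :=
  ⟨fun h => h p (List.prefix_refl p), fun h _ hq => h.of_prefix hq⟩

end Sequences

/-! ### Positions, plays and strategies -/

theorem Player.turn_II_iff (n : ℕ) : Player.II.Turn n ↔ ¬ Player.I.Turn n := by
  simp [Player.Turn]

theorem Player.turn_succ_iff (P : Player) (n : ℕ) : P.Turn (n + 1) ↔ ¬ P.Turn n := by
  cases P <;> simp [Player.Turn, Nat.even_add_one, Nat.odd_add_one]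

namespace GameTree

variable {X : Type u} {T : GameTree X} {P : Player}

theorem nil_mem (T : GameTree X) : [] ∈ T.positions :=
  let ⟨q, hq⟩ := T.nonempty
  T.closed [] q hq List.nil_prefix

theorem not_terminal_of_append {p : List X} {a : X} (h : p ++ [a] ∈ T.positions) :
    ¬ T.Terminal p :=
  fun ht => ht.2 ⟨_, h, List.prefix_append _ _, by simp⟩

theorem exists_move {p : List X} (hp : p ∈ T.positions) (ht : ¬ T.Terminal p) :
    ∃ a, T.IsMove p a := by
  simp only [Terminal, not_and, not_not] at ht
  obtain ⟨q, hq, ⟨r, rfl⟩, hne⟩ := ht hp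
  cases r with
  | nil => simp at hne
  | cons a r =>
    refine ⟨a, T.closed _ _ hq ?_⟩
    exact ⟨r, by simp⟩

theorem Terminal.eq_of_prefix {p q : List X} (h : T.Terminal p) (hq : q ∈ T.positions)
    (hpq : p <+: q) : p = q := by
  by_contra hne
  exact h.2 ⟨q, hq, hpq, hne⟩

theorem Play.mem_of_hasInit (x : T.Play) {p : List X} (h : FinInfSeq.HasInit p x.1) :
    p ∈ T.positions := by
  obtain ⟨s, hs⟩ := x
  cases s with
  | fin r => exact T.closed p r hs.1 h
  | inf x =>
    change p = _ at h
    rw [h]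
    exact hs _

namespace Strategy

/-- The strategy that picks at each decision `p` a move `a` with `R p a`, if there is a legal one,
and an arbitrary legal move otherwise. -/
noncomputable def ofRel (T : GameTree X) (P : Player) (R : List X → X → Prop) :
    T.Strategy P where
  move p := open Classical in
    if h : ∃ a, T.IsMove p.1 a ∧ R p.1 a then h.choose
    else (exists_move p.2.1 p.2.2.1).choose
  legal p := by
    split_ifs with h
    · exact h.choose_spec.1
    · exact (exists_move p.2.1 p.2.2.1).choose_spec

theorem ofRel_spec {R : List X → X → Prop} {p : T.Decision P}
    (h : ∃ a, T.IsMove p.1 a ∧ R p.1 a) : R p.1 ((ofRel T P R).move p) := by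
  simp only [ofRel, dif_pos h]
  exact h.choose_spec.2

theorem ofRel_congr {R R' : List X → X → Prop} {p : T.Decision P}
    (h : ∀ a, R p.1 a ↔ R' p.1 a) : (ofRel T P R).move p = (ofRel T P R').move p := by
  have : R p.1 = R' p.1 := funext fun a => propext (h a)
  open Classical in
  exact congrArg (fun r : X → Prop => if h : ∃ a, T.IsMove p.1 a ∧ r a then h.choose
    else (exists_move p.2.1 p.2.2.1).choose) this

/-- `q` is a position where the owner of `σ` has to move, and `σ` plays `y` there. -/
def Follows (σ : T.Strategy P) (q : List X) (y : X) : Prop :=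
  ∃ h : q ∈ T.positions ∧ ¬ T.Terminal q ∧ P.Turn q.length, σ.move ⟨q, h⟩ = y

theorem Follows.mem {σ : T.Strategy P} {q : List X} {y : X} (h : σ.Follows q y) :
    q ++ [y] ∈ T.positions := by
  obtain ⟨hq, rfl⟩ := h
  exact σ.legal ⟨q, hq⟩

theorem Follows.unique {σ : T.Strategy P} {q : List X} {y z : X} (h : σ.Follows q y)
    (h' : σ.Follows q z) : y = z := by
  obtain ⟨hq, rfl⟩ := h
  obtain ⟨_, rfl⟩ := h'
  rfl

theorem Follows.of_ofRel {R : List X → X → Prop} {p : List X} {a : X}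
    (h : (ofRel T P R).Follows p a) (hR : ∃ b, p ++ [b] ∈ T.positions ∧ R p b) : R p a := by
  obtain ⟨hp, rfl⟩ := h
  exact ofRel_spec (p := ⟨p, hp⟩) hR

theorem exists_follows (σ : T.Strategy P) {q : List X} (hq : q ∈ T.positions)
    (ht : ¬ T.Terminal q) (hP : P.Turn q.length) : ∃ y, σ.Follows q y :=
  ⟨_, ⟨hq, ht, hP⟩, rfl⟩

theorem follows_move (σ : T.Strategy P) (q : T.Decision P) : σ.Follows q.1 (σ.move q) :=
  ⟨q.2, rfl⟩

theorem consistentPos_iff {σ : T.Strategy P} {p : T.Pos} : σ.ConsistentPos p ↔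
    ∀ q y, q ++ [y] <+: p.1 → P.Turn q.length → σ.Follows q y := by
  constructor
  · intro h q y hq ht
    have hm : q ++ [y] ∈ T.positions := T.closed _ _ p.2 hq
    refine ⟨⟨T.closed _ _ hm (List.prefix_append _ _), not_terminal_of_append hm, ht⟩, ?_⟩
    exact (h _ y hq).symm
  · intro h q a hq
    exact (h q.1 a hq q.2.2.2).unique (σ.follows_move q)

theorem ConsistentPlay.follows {σ : T.Strategy P} {x : T.Play} (h : σ.ConsistentPlay x)
    {q : List X} {y : X} (hq : FinInfSeq.HasInit (q ++ [y]) x.1) (ht : P.Turn q.length) :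
    σ.Follows q y :=
  consistentPos_iff.1 (h ⟨_, x.mem_of_hasInit hq⟩ hq) q y (List.prefix_refl _) ht

theorem consistentPlay_of_follows {σ : T.Strategy P} {x : T.Play}
    (h : ∀ q y, FinInfSeq.HasInit (q ++ [y]) x.1 → P.Turn q.length → σ.Follows q y) :
    σ.ConsistentPlay x := fun _ hp =>
  consistentPos_iff.2 fun q y hq ht => h q y (hp.of_prefix hq) ht

/-- `σ` and `τ` make the same moves at positions of length `< n`. -/
def AgreeBelow (n : ℕ) (σ τ : T.Strategy P) : Prop :=
  ∀ q : T.Decision P, q.1.length < n → σ.move q = τ.move q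

theorem AgreeBelow.follows_iff {n : ℕ} {σ τ : T.Strategy P} (h : AgreeBelow n σ τ) {q : List X}
    (hq : q.length < n) (y : X) : σ.Follows q y ↔ τ.Follows q y := by
  constructor
  · rintro ⟨hd, rfl⟩
    exact ⟨hd, (h ⟨q, hd⟩ hq).symm⟩
  · rintro ⟨hd, rfl⟩
    exact ⟨hd, h ⟨q, hd⟩ hq⟩

end Strategy

/-! ### The topology of the space of branches -/

theorem Branch.ext {x y : T.Branch} (h : ∀ n, initSeg x.1 n = initSeg y.1 n) : x = y :=
  Subtype.ext (initSeg_injective h)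

theorem subtree_isPlay_inf_iff {p : List X} (x : T.Branch) :
    (T.subtree p).IsPlay (.inf x.1) ↔ initSeg x.1 p.length = p := by
  constructor
  · intro h
    rcases (h p.length).2 with h | h
    · exact h.eq_of_length (by simp)
    · exact (h.eq_of_length (by simp)).symm
  · intro h n
    refine ⟨x.2 n, ?_⟩
    rw [← h]
    rcases le_total n p.length with hn | hn
    · exact Or.inl (initSeg_prefix _ hn)
    · exact Or.inr (initSeg_prefix _ hn)

/-- The topology of `[T]` is that of agreement on finite initial segments. -/
theorem isOpen_branch_iff {U : Set T.Branch} : IsOpen U ↔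
    ∀ x ∈ U, ∃ n, ∀ y : T.Branch, initSeg y.1 n = initSeg x.1 n → y ∈ U := by
  have hcyl : ∀ p ∈ T.positions, Branch.toPlay ⁻¹' {s : T.Play | (T.subtree p).IsPlay s.1} =
      {x : T.Branch | initSeg x.1 p.length = p} := by
    intro p _
    ext x
    exact subtree_isPlay_inf_iff x
  constructor
  · rintro ⟨V, hV, rfl⟩
    change TopologicalSpace.GenerateOpen _ V at hV
    induction hV with
    | basic s hs =>
      obtain ⟨p, hp, rfl⟩ := hs
      rw [hcyl p hp]
      intro x hx
      exact ⟨p.length, fun y hy => hy.trans hx⟩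
    | univ => exact fun x _ => ⟨0, fun y _ => trivial⟩
    | inter s t _ _ hs ht =>
      rintro x ⟨hxs, hxt⟩
      obtain ⟨n, hn⟩ := hs x hxs
      obtain ⟨m, hm⟩ := ht x hxt
      refine ⟨max n m, fun y hy => ⟨hn y ?_, hm y ?_⟩⟩
      · rw [← take_initSeg y.1 (le_max_left n m), hy, take_initSeg _ (le_max_left n m)]
      · rw [← take_initSeg y.1 (le_max_right n m), hy, take_initSeg _ (le_max_right n m)]
    | sUnion S _ hS =>
      rintro x ⟨s, hs, hx⟩
      obtain ⟨n, hn⟩ := hS s hs x hx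
      exact ⟨n, fun y hy => ⟨s, hs, hn y hy⟩⟩
  · intro h
    choose! n hn using h
    have : U = ⋃ x ∈ U, {y : T.Branch | initSeg y.1 (n x) = initSeg x.1 (n x)} := by
      ext y
      simp only [Set.mem_iUnion, Set.mem_ofPred_eq, exists_prop]
      exact ⟨fun hy => ⟨y, hy, rfl⟩, fun ⟨x, hx, hy⟩ => hn x hx y hy⟩
    rw [this]
    refine isOpen_biUnion fun x _ => ?_
    refine ⟨{s | (T.subtree (initSeg x.1 (n x))).IsPlay s.1},
      TopologicalSpace.GenerateOpen.basic _ ⟨_, x.2 _, rfl⟩, ?_⟩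
    rw [hcyl _ (x.2 _)]
    simp

end GameTree

namespace TabooTree

variable {X : Type u} {T : TabooTree X}

theorem terminal_of_mem_taboo {P : Player} {p : List X} (h : p ∈ T.taboo P) : T.Terminal p := by
  have : p ∈ T.taboo .I ∪ T.taboo .II := by cases P <;> simp [h]
  rwa [T.taboo_union] at this

theorem exists_mem_taboo {p : List X} (h : T.Terminal p) : ∃ P, p ∈ T.taboo P := by
  have : p ∈ T.taboo .I ∪ T.taboo .II := by rw [T.taboo_union]; exact h
  rcases this with h | h
  exacts [⟨_, h⟩, ⟨_, h⟩]

end TabooTree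

/-! ### Position maps -/

namespace PositionMap

variable {X : Type u} {Y : Type v} {Z : Type w}
  {T : TabooTree X} {T' : TabooTree Y} {T'' : TabooTree Z}

/-- The composition of two position maps. -/
def comp (f : PositionMap T' T) (g : PositionMap T'' T') : PositionMap T'' T where
  toFun p := f.toFun (g.toFun p)
  mono _ _ h := f.mono _ _ (g.mono _ _ h)
  length_eq p := (f.length_eq _).trans (g.length_eq p)
  taboo P p h := g.taboo P p (f.taboo P _ h)

/-- The identity position map. -/
def id (T : TabooTree X) : PositionMap T T where
  toFun p := p
  mono _ _ h := h
  length_eq _ := rfl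
  taboo _ _ h := h

theorem initSeg_branchMap (f : PositionMap T' T) (x : T'.Branch) (n : ℕ) :
    initSeg (f.branchMap x).1 n = (f.toFun ⟨initSeg x.1 n, x.2 n⟩).1 :=
  f.initSeg_branchSeq x n

theorem branchMap_comp (f : PositionMap T' T) (g : PositionMap T'' T') (x : T''.Branch) :
    (f.comp g).branchMap x = f.branchMap (g.branchMap x) := by
  refine GameTree.Branch.ext fun n => ?_
  rw [initSeg_branchMap, initSeg_branchMap]
  simp only [initSeg_branchMap]
  rfl

theorem branchMap_id (x : T.Branch) : (PositionMap.id T).branchMap x = x := by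
  refine GameTree.Branch.ext fun n => ?_
  rw [initSeg_branchMap]
  rfl

theorem continuous_branchMap (f : PositionMap T' T) : Continuous f.branchMap := by
  refine continuous_def.2 fun U hU => ?_
  rw [GameTree.isOpen_branch_iff] at hU ⊢
  intro x hx
  obtain ⟨n, hn⟩ := hU _ hx
  refine ⟨n, fun y hy => hn _ ?_⟩
  rw [initSeg_branchMap, initSeg_branchMap]
  simp only [hy]

theorem hasInit_playMap (f : PositionMap T' T) {y : T'.Play} {p : T'.Pos}
    (h : FinInfSeq.HasInit p.1 y.1) : FinInfSeq.HasInit (f.toFun p).1 (f.playMap y) := by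
  obtain ⟨s, hs⟩ := y
  cases s with
  | fin q => exact f.mono p ⟨q, hs.1⟩ h
  | inf x =>
    let b : T'.Branch := ⟨x, hs⟩
    change p.1 = initSeg b.1 _ at h
    change _ = initSeg (f.branchMap b).1 _
    rw [initSeg_branchMap, f.length_eq]
    congr 2
    exact Subtype.ext h

theorem playMap_of_eq_fin (f : PositionMap T' T) {y : T'.Play} {p : T'.Pos}
    (h : y.1 = .fin p.1) : f.playMap y = .fin (f.toFun p).1 := by
  obtain ⟨s, hs⟩ := y
  cases s with
  | fin q => cases h; rfl
  | inf x => cases h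

/-- Every initial segment of the image of a play is the image of an initial segment. -/
theorem exists_of_hasInit_playMap (f : PositionMap T' T) {y : T'.Play} {p : List X}
    (h : FinInfSeq.HasInit p (f.playMap y)) :
    ∃ q : T'.Pos, FinInfSeq.HasInit q.1 y.1 ∧ (f.toFun q).1 = p := by
  obtain ⟨s, hs⟩ := y
  cases s with
  | fin q =>
    have hp : p <+: (f.toFun ⟨q, hs.1⟩).1 := h
    have hl : p.length ≤ q.length := by
      have := hp.length_le
      rwa [f.length_eq] at this
    have hq : q.take p.length ∈ T'.positions := T'.closed _ _ hs.1 (List.take_prefix _ _)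
    refine ⟨⟨_, hq⟩, List.take_prefix _ _, ?_⟩
    refine (List.prefix_of_prefix_length_le
      (f.mono ⟨_, hq⟩ ⟨q, hs.1⟩ (List.take_prefix _ _)) hp ?_).eq_of_length ?_
    · rw [f.length_eq]; simp
    · rw [f.length_eq]; simp [hl]
  | inf x =>
    let b : T'.Branch := ⟨x, hs⟩
    change p = initSeg (f.branchMap b).1 _ at h
    rw [initSeg_branchMap] at h
    exact ⟨⟨_, hs p.length⟩, by simp [FinInfSeq.HasInit], h.symm⟩

theorem playMap_comp (f : PositionMap T' T) (g : PositionMap T'' T') {z : T''.Play} {y : T'.Play}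
    (h : g.playMap z = y.1) : (f.comp g).playMap z = f.playMap y := by
  obtain ⟨s, hs⟩ := y
  obtain ⟨r, hr⟩ := z
  cases r with
  | fin q =>
    simp only [playMap] at h
    subst h
    rfl
  | inf x =>
    simp only [playMap] at h
    subst h
    let b : T''.Branch := ⟨x, hr⟩
    change FinInfSeq.inf ((f.comp g).branchMap b).1 = .inf (f.branchMap (g.branchMap b)).1
    rw [branchMap_comp]

end PositionMap

/-! ### Coverings between two given trees -/

/-- A covering of `T` by `T'`, with the covering tree as a parameter. -/
structure Cov {Y : Type v} {X : Type u} (T' : TabooTree Y) (T : TabooTree X) where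
  posMap : PositionMap T' T
  stratMap : ∀ P : Player, T'.Strategy P → T.Strategy P
  stratMap_local : ∀ (P : Player) (n : ℕ) (σ τ : T'.Strategy P),
    GameTree.Strategy.AgreeBelow n σ τ →
    GameTree.Strategy.AgreeBelow n (stratMap P σ) (stratMap P τ)
  lifting : ∀ (P : Player) (σ : T'.Strategy P) (x : T.Play),
    (stratMap P σ).ConsistentPlay x →
    ∃ y : T'.Play, σ.ConsistentPlay y ∧ (posMap.playMap y).Sub x.1 ∧
      (posMap.playMap y = x.1 ∨ T'.IsTabooFor P y)

namespace Cov

variable {X : Type u} {Y : Type v} {Z : Type w}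
  {T : TabooTree X} {T' : TabooTree Y} {T'' : TabooTree Z}

/-- The covering, with its covering tree bundled. -/
def toTabooCovering (C : Cov T' T) : TabooCovering T Y where
  tree := T'
  posMap := C.posMap
  stratMap := C.stratMap
  stratMap_local := C.stratMap_local
  lifting := C.lifting

/-- Composition of coverings. -/
def comp (C : Cov T' T) (D : Cov T'' T') : Cov T'' T where
  posMap := C.posMap.comp D.posMap
  stratMap P σ := C.stratMap P (D.stratMap P σ)
  stratMap_local P n σ τ h := C.stratMap_local P n _ _ (D.stratMap_local P n σ τ h)
  lifting P σ x hx := by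
    obtain ⟨y, hy, hyx, hy'⟩ := C.lifting P _ x hx
    obtain ⟨z, hz, hzy, hz'⟩ := D.lifting P σ y hy
    refine ⟨z, hz, fun p hp => ?_, ?_⟩
    · obtain ⟨q, hq, rfl⟩ := PositionMap.exists_of_hasInit_playMap _ hp
      exact hyx _ (C.posMap.hasInit_playMap (hzy _ (D.posMap.hasInit_playMap hq)))
    · rcases hz' with hz' | hz'
      · rcases hy' with hy' | ⟨p, hp, hyp⟩
        · exact Or.inl ((PositionMap.playMap_comp _ _ hz').trans hy')
        · -- The intermediate play is taboo, and position maps reflect taboos.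
          right
          obtain ⟨s, hs⟩ := z
          rw [hyp] at hz'
          cases s with
          | inf s => cases hz'
          | fin q =>
            refine ⟨q, D.posMap.taboo P ⟨q, hs.1⟩ ?_, rfl⟩
            simp only [PositionMap.playMap, FinInfSeq.fin.injEq] at hz'
            rwa [hz']
      · exact Or.inr hz'

/-- The `k`-covering condition, in terms of the position map: it is a bijection up to level `k`
given by relabelling along `ι`, it reflects taboos there, and the strategy map preserves the moves
made at positions of length `< k`. -/
structure IsK (C : Cov T' T) (ι : X ↪ Y) (k : ℕ) : Prop where
  map_posMap : ∀ q : T'.Pos, q.1.length ≤ k → (C.posMap.toFun q).1.map ι = q.1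
  map_mem : ∀ p ∈ T.positions, p.length ≤ k → p.map ι ∈ T'.positions
  taboo_posMap : ∀ P (q : T'.Pos), q.1.length ≤ k → q.1 ∈ T'.taboo P →
    (C.posMap.toFun q).1 ∈ T.taboo P
  follows : ∀ P (σ : T'.Strategy P) (p : List X) (a : X), p.length < k →
    (C.stratMap P σ).Follows p a → σ.Follows (p.map ι) (ι a)

namespace IsK

variable {C : Cov T' T} {ι : X ↪ Y} {k : ℕ}

theorem posMap_map (h : C.IsK ι k) {p : List X} (hp : p ∈ T.positions) (hk : p.length ≤ k) :
    (C.posMap.toFun ⟨p.map ι, h.map_mem p hp hk⟩).1 = p :=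
  List.map_injective_iff.2 ι.injective (h.map_posMap _ (by simpa using hk))

theorem injective (h : C.IsK ι k) {q r : T'.Pos} (hq : q.1.length ≤ k)
    (hqr : (C.posMap.toFun q).1 = (C.posMap.toFun r).1) : q = r := by
  have hr : r.1.length ≤ k := by
    rw [← C.posMap.length_eq, ← hqr, C.posMap.length_eq]; exact hq
  exact Subtype.ext (by rw [← h.map_posMap q hq, hqr, h.map_posMap r hr])

theorem comp (h : C.IsK ι k) {D : Cov T'' T'} {κ : Y ↪ Z} (h' : D.IsK κ k) :
    (C.comp D).IsK (ι.trans κ) k where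
  map_posMap q hq := by
    have h1 := h.map_posMap (D.posMap.toFun q) (by rwa [D.posMap.length_eq])
    have h2 := h'.map_posMap q hq
    rw [← h1, List.map_map] at h2
    exact h2
  map_mem p hp hk := by
    have := h'.map_mem _ (h.map_mem p hp hk) (by simpa using hk)
    rwa [List.map_map] at this
  taboo_posMap P q hq hqt :=
    h.taboo_posMap P _ (by rwa [D.posMap.length_eq]) (h'.taboo_posMap P q hq hqt)
  follows P σ p a hp hf := by
    have := h'.follows P σ _ _ (by simpa using hp) (h.follows P _ p a hp hf)
    rwa [List.map_map] at this

theorem isKCovering (h : C.IsK ι k) : C.toTabooCovering.IsKCovering ι k where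
  positions_eq := by
    ext q
    constructor
    · rintro ⟨hq, hk⟩
      exact ⟨(C.posMap.toFun ⟨q, hq⟩).1, ⟨(C.posMap.toFun ⟨q, hq⟩).2,
        by rwa [C.posMap.length_eq]⟩, h.map_posMap ⟨q, hq⟩ hk⟩
    · rintro ⟨p, ⟨hp, hk⟩, rfl⟩
      exact ⟨h.map_mem p hp hk, by simpa using hk⟩
  taboo_eq P := by
    ext q
    constructor
    · rintro ⟨hqt, hk⟩
      have hq := (TabooTree.terminal_of_mem_taboo hqt).1
      exact ⟨(C.posMap.toFun ⟨q, hq⟩).1, ⟨h.taboo_posMap P ⟨q, hq⟩ hk hqt,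
        by rwa [C.posMap.length_eq]⟩, h.map_posMap ⟨q, hq⟩ hk⟩
    · rintro ⟨p, ⟨hp, hk⟩, rfl⟩
      refine ⟨?_, by simpa using hk⟩
      have hpT := (TabooTree.terminal_of_mem_taboo hp).1
      refine C.posMap.taboo P ⟨_, h.map_mem p hpT hk⟩ ?_
      rwa [h.posMap_map hpT hk]
  posMap_eq := h.map_posMap
  stratMap_eq P σ q p hp hqp := by
    have := h.follows P σ p.1 _ hp ((C.stratMap P σ).follows_move p)
    rw [← hqp] at this
    exact this.unique (σ.follows_move q)

end IsK

end Cov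

/-- `A ⊆ [T]` is unraveled by some `k`-covering. -/
def Unravelable {X : Type u} (T : TabooTree X) (k : ℕ) (A : Set T.Branch) : Prop :=
  ∃ (Y : Type u) (T' : TabooTree Y) (C : Cov T' T) (ι : X ↪ Y),
    C.IsK ι k ∧ IsClopen (C.posMap.branchMap ⁻¹' A)

/-! ### Labelled positions -/

/-- The letters of the tree unraveling an open set: a move of the given tree, together with a set
of positions (used by the move at level `k` only) and possibly a position (used by the move at
level `k + 1` only). -/
abbrev Letter (X : Type u) : Type u := X × Set (List X) × Option (List X)

namespace Letter

variable {X : Type u}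

/-- The letter for the move `a` at level `i`, when the additional moves at levels `k` and `k + 1`
are `𝒳` and `o`. -/
def tag (k : ℕ) (𝒳 : Set (List X)) (o : Option (List X)) (i : ℕ) (a : X) : Letter X :=
  open Classical in (a, if i = k then 𝒳 else ∅, if i = k + 1 then o else none)

/-- The letters without an additional move. -/
def plain (X : Type u) : X ↪ Letter X := ⟨fun a => (a, ∅, none), fun _ _ h => congrArg Prod.fst h⟩

/-- The position `p` with the additional moves `𝒳` and `o` at levels `k` and `k + 1`. -/
def lift (k : ℕ) (𝒳 : Set (List X)) (o : Option (List X)) (p : List X) : List (Letter X) :=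
  p.mapIdx (tag k 𝒳 o)

variable {k : ℕ} {𝒳 𝒳' : Set (List X)} {o o' : Option (List X)} {p p' : List X}

theorem tag_congr {i : ℕ} (h : i = k → 𝒳 = 𝒳') (h' : i = k + 1 → o = o') (a : X) :
    tag k 𝒳 o i a = tag k 𝒳' o' i a := by
  unfold tag
  by_cases h1 : i = k
  · have h2 : i ≠ k + 1 := by omega
    simp [h1, h h1]
  · by_cases h2 : i = k + 1
    · simp [h2, h' h2]
    · simp [h1, h2]

theorem lift_append (p : List X) (a : X) :
    lift k 𝒳 o (p ++ [a]) = lift k 𝒳 o p ++ [tag k 𝒳 o p.length a] := by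
  simp [lift, List.mapIdx_append]

@[simp] theorem length_lift : (lift k 𝒳 o p).length = p.length := by simp [lift]

@[simp] theorem map_fst_lift : (lift k 𝒳 o p).map Prod.fst = p := by
  apply List.ext_getElem <;> simp [lift, tag]

theorem lift_prefix (h : p <+: p') : lift k 𝒳 o p <+: lift k 𝒳 o p' := by
  obtain ⟨r, rfl⟩ := h
  simp [lift, List.mapIdx_append]

theorem exists_of_prefix_lift {q : List (Letter X)} (h : q <+: lift k 𝒳 o p) :
    ∃ p', p' <+: p ∧ q = lift k 𝒳 o p' := by
  refine ⟨p.take q.length, List.take_prefix _ _, ?_⟩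
  have hl := h.length_le
  rw [length_lift] at hl
  refine (List.prefix_of_prefix_length_le h (lift_prefix (List.take_prefix _ _)) ?_).eq_of_length ?_
  · simp [hl]
  · simp [hl]

theorem lift_congr (h : k < p.length → 𝒳 = 𝒳') (h' : k + 1 < p.length → o = o') :
    lift k 𝒳 o p = lift k 𝒳' o' p := by
  apply List.ext_getElem (by simp)
  intro i h1 _
  rw [length_lift] at h1
  simp only [lift, List.getElem_mapIdx]
  exact tag_congr (fun e => h (by omega)) (fun e => h' (by omega)) _

theorem lift_eq_map (h : p.length ≤ k) : lift k 𝒳 o p = p.map (plain X) := by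
  apply List.ext_getElem (by simp)
  intro i h1 _
  rw [length_lift] at h1
  have h2 : i ≠ k := by omega
  have h3 : i ≠ k + 1 := by omega
  simp only [lift, tag, List.getElem_mapIdx, List.getElem_map, if_neg h2, if_neg h3]
  rfl

theorem tag_eq_plain {i : ℕ} (h : i < k) (a : X) : tag k 𝒳 o i a = plain X a := by
  have h2 : i ≠ k := by omega
  have h3 : i ≠ k + 1 := by omega
  simp only [tag, if_neg h2, if_neg h3]
  rfl

theorem eq_of_lift_eq (h : lift k 𝒳 o p = lift k 𝒳' o' p') : p = p' := by
  simpa using congrArg (List.map Prod.fst) h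

theorem set_eq_of_lift_eq (h : lift k 𝒳 o p = lift k 𝒳' o' p') (hk : k < p.length) :
    𝒳 = 𝒳' := by
  obtain rfl := eq_of_lift_eq h
  have := List.getElem_of_eq h (i := k) (by simpa using hk)
  simp only [lift, List.getElem_mapIdx, tag, if_true] at this
  exact congrArg (fun l : Letter X => l.2.1) this

theorem option_eq_of_lift_eq (h : lift k 𝒳 o p = lift k 𝒳' o' p') (hk : k + 1 < p.length) :
    o = o' := by
  obtain rfl := eq_of_lift_eq h
  have := List.getElem_of_eq h (i := k + 1) (by simpa using hk)
  simp only [lift, List.getElem_mapIdx, tag, if_true] at this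
  exact congrArg (fun l : Letter X => l.2.2) this

theorem initSeg_tag (x : ℕ → X) (n : ℕ) :
    initSeg (fun i => tag k 𝒳 o i (x i)) n = lift k 𝒳 o (initSeg x n) := by
  induction n with
  | zero => simp [initSeg, lift]
  | succ n ih => rw [initSeg_succ, initSeg_succ, lift_append, ih, length_initSeg]

end Letter

open Letter

/-! ### The tree unraveling an open set -/

/-- `B` is a set of pairwise incomparable nonterminal positions of length at least `k + 2`. -/
structure IsBarrier {X : Type u} (T : GameTree X) (k : ℕ) (B : Set (List X)) : Prop where
  mem : ∀ u ∈ B, u ∈ T.positions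
  not_terminal : ∀ u ∈ B, ¬ T.Terminal u
  le_length : ∀ u ∈ B, k + 2 ≤ u.length
  antichain : ∀ u ∈ B, ∀ v ∈ B, u <+: v → u = v

/-- The position `p` may occur together with the additional moves `𝒳` and `o`: the set `𝒳`
consists of elements of `B`; if `o` is `some u`, then `u ∈ 𝒳` and the play goes through `u`; if `o`
is `none`, then the play stops as soon as it reaches an element of `B`. -/
def ValidLift {X : Type u} (T : GameTree X) (B : Set (List X)) (p : List X)
    (𝒳 : Set (List X)) (o : Option (List X)) : Prop :=
  p ∈ T.positions ∧ 𝒳 ⊆ B ∧ (o = none → ∀ v ∈ B, v <+: p → v = p) ∧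
    ∀ u, o = some u → u ∈ 𝒳 ∧ (u <+: p ∨ p <+: u)

section

variable {X : Type u} {k : ℕ} {B : Set (List X)} {p p' : List X} {𝒳 : Set (List X)}
  {o : Option (List X)}

theorem ValidLift.of_prefix {T : GameTree X} (h : ValidLift T B p 𝒳 o) (hp : p' <+: p) :
    ValidLift T B p' 𝒳 o := by
  refine ⟨T.closed _ _ h.1 hp, h.2.1, fun ho v hv hvp => ?_, fun u hu => ⟨(h.2.2.2 u hu).1, ?_⟩⟩
  · have := h.2.2.1 ho v hv (hvp.trans hp)
    subst this
    exact hvp.eq_of_length_le hp.length_le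
  · rcases (h.2.2.2 u hu).2 with h | h
    · exact List.prefix_or_prefix_of_prefix h hp
    · exact Or.inr (hp.trans h)

/-- The game tree in which the player who moves at level `k` additionally names a set `𝒳 ⊆ B`, and
the opponent, at level `k + 1`, either picks some `u ∈ 𝒳`, after which the play is forced to go
through `u`, or accepts, after which the play stops when it reaches `B`. -/
def liftTree (T : GameTree X) (k : ℕ) (B : Set (List X)) : GameTree (Letter X) where
  positions := {q | ∃ p 𝒳 o, ValidLift T B p 𝒳 o ∧ q = lift k 𝒳 o p}
  nonempty := ⟨[], [], ∅, none,
    ⟨T.nil_mem, by simp, fun _ v _ hv => by simpa using hv, by simp⟩, rfl⟩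
  closed := by
    rintro q _ ⟨p, 𝒳, o, hv, rfl⟩ hq
    obtain ⟨p', hp', rfl⟩ := exists_of_prefix_lift hq
    exact ⟨p', 𝒳, o, hv.of_prefix hp', rfl⟩

end

namespace IsBarrier

variable {X : Type u} {k : ℕ} {B : Set (List X)} {p p' : List X} {𝒳 𝒳' : Set (List X)}
  {o : Option (List X)}

theorem eq_of_prefix {T : GameTree X} (hB : IsBarrier T k B) {u v : List X} (hu : u ∈ B)
    (hv : v ∈ B) (hup : u <+: p) (hvp : v <+: p) : u = v := by
  rcases List.prefix_or_prefix_of_prefix hup hvp with h | h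
  · exact hB.antichain u hu v hv h
  · exact (hB.antichain v hv u hu h).symm

theorem terminal_lift_iff {T : GameTree X} (hB : IsBarrier T k B) (h : ValidLift T B p 𝒳 o) :
    (liftTree T k B).Terminal (lift k 𝒳 o p) ↔ T.Terminal p ∨ (o = none ∧ p ∈ B) := by
  constructor
  · intro ht
    by_contra hcon
    push Not at hcon
    have key : ∃ a, ValidLift T B (p ++ [a]) 𝒳 o := by
      obtain ⟨b, hb⟩ := GameTree.exists_move h.1 hcon.1
      cases o with
      | none =>
        refine ⟨b, hb, h.2.1, fun _ v hv hvp => ?_, by simp⟩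
        rcases List.prefix_concat_iff.1 hvp with hvp | hvp
        · exact hvp
        · exact absurd (h.2.2.1 rfl v hv hvp ▸ hv) (hcon.2 rfl)
      | some u =>
        obtain ⟨hu, hup⟩ := h.2.2.2 u rfl
        by_cases hle : u <+: p
        · refine ⟨b, hb, h.2.1, by simp, ?_⟩
          rintro _ ⟨⟩
          exact ⟨hu, Or.inl (hle.trans (List.prefix_append _ _))⟩
        · obtain ⟨r, rfl⟩ := hup.resolve_left hle
          cases r with
          | nil => simp at hle
          | cons a r =>
            have hpa : p ++ [a] <+: p ++ a :: r := ⟨r, by simp⟩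
            refine ⟨a, T.closed _ _ (hB.mem _ (h.2.1 hu)) hpa, h.2.1, by simp, ?_⟩
            rintro _ ⟨⟩
            exact ⟨hu, Or.inr hpa⟩
    obtain ⟨a, ha⟩ := key
    refine ht.2 ⟨lift k 𝒳 o (p ++ [a]), ⟨_, _, _, ha, rfl⟩, lift_prefix (List.prefix_append _ _), ?_⟩
    intro he
    simpa using congrArg List.length he
  · intro hcase
    refine ⟨⟨p, 𝒳, o, h, rfl⟩, ?_⟩
    rintro ⟨_, ⟨p', 𝒳', o', h', rfl⟩, hpre, hne⟩
    have hpp : p <+: p' := by simpa using hpre.map Prod.fst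
    have hpe : p = p' := by
      rcases hcase with ht | ⟨rfl, hpB⟩
      · exact ht.eq_of_prefix h'.1 hpp
      · have he : lift k 𝒳 none p = lift k 𝒳' o' p :=
          (List.prefix_of_prefix_length_le hpre (lift_prefix hpp) (by simp)).eq_of_length (by simp)
        have hl := hB.le_length p hpB
        have := option_eq_of_lift_eq he (by omega)
        exact h'.2.2.1 this.symm p hpB hpp
    exact hne (hpre.eq_of_length (by simp [hpe]))

/-- The tree `liftTree T k B` with taboos. Plays that are terminal in the given tree keep their
taboo. The player who moves at level `k` claims that no element of `B \ 𝒳` will be reached, and an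
opponent who accepts claims that no element of `𝒳` will be reached; reaching `B` is taboo for the
player whose claim is violated. -/
def tabooTree {T : TabooTree X} (hB : IsBarrier T.toGameTree k B) :
    TabooTree (Letter X) where
  toGameTree := liftTree T.toGameTree k B
  taboo P := {q | ∃ p 𝒳 o, ValidLift T.toGameTree B p 𝒳 o ∧ q = lift k 𝒳 o p ∧
    (p ∈ T.taboo P ∨ (o = none ∧ p ∈ B ∧ (P.Turn k ↔ p ∉ 𝒳)))}
  taboo_disjoint := by
    rw [Set.disjoint_left]
    rintro _ ⟨p, 𝒳, o, h, rfl, ht⟩ ⟨p', 𝒳', o', h', he, ht'⟩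
    obtain rfl := eq_of_lift_eq he
    rcases ht with ht | ⟨-, hpB, ht⟩ <;> rcases ht' with ht' | ⟨-, hpB', ht'⟩
    · exact Set.disjoint_left.1 T.taboo_disjoint ht ht'
    · exact hB.not_terminal _ hpB' (TabooTree.terminal_of_mem_taboo ht)
    · exact hB.not_terminal _ hpB (TabooTree.terminal_of_mem_taboo ht')
    · have := hB.le_length _ hpB
      obtain rfl := set_eq_of_lift_eq he (by omega)
      rw [Player.turn_II_iff] at ht'
      tauto
  taboo_union := by
    ext q
    constructor
    · rintro (⟨p, 𝒳, o, h, rfl, ht⟩ | ⟨p, 𝒳, o, h, rfl, ht⟩)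
      all_goals
        refine (hB.terminal_lift_iff h).2 ?_
        rcases ht with ht | ⟨ho, hp, -⟩
        · exact Or.inl (TabooTree.terminal_of_mem_taboo ht)
        · exact Or.inr ⟨ho, hp⟩
    · intro ht
      obtain ⟨p, 𝒳, o, h, rfl⟩ := ht.1
      rcases (hB.terminal_lift_iff h).1 ht with ht | ⟨ho, hp⟩
      · obtain ⟨P, hP⟩ := TabooTree.exists_mem_taboo ht
        cases P
        · exact Or.inl ⟨p, 𝒳, o, h, rfl, Or.inl hP⟩
        · exact Or.inr ⟨p, 𝒳, o, h, rfl, Or.inl hP⟩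
      · by_cases hc : Player.I.Turn k ↔ p ∉ 𝒳
        · exact Or.inl ⟨p, 𝒳, o, h, rfl, Or.inr ⟨ho, hp, hc⟩⟩
        · refine Or.inr ⟨p, 𝒳, o, h, rfl, Or.inr ⟨ho, hp, ?_⟩⟩
          rw [Player.turn_II_iff]
          tauto

open GameTree

section Strategies

variable {T : TabooTree X} {P : Player}

/-- The projection of the lifted positions to the given tree. -/
def posMap (hB : IsBarrier T.toGameTree k B) : PositionMap hB.tabooTree T where
  toFun q := ⟨q.1.map Prod.fst, by
    obtain ⟨_, p, 𝒳, o, h, rfl⟩ := q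
    rw [map_fst_lift]
    exact h.1⟩
  mono _ _ h := h.map _
  length_eq _ := List.length_map _
  taboo P q hq := by
    obtain ⟨p, 𝒳, o, h, he⟩ := q.2
    change q.1.map Prod.fst ∈ _ at hq
    rw [he, map_fst_lift] at hq
    exact ⟨p, 𝒳, o, h, he, Or.inl hq⟩

variable {hB : IsBarrier T.toGameTree k B}

/-- `σ` moves from `lift k 𝒳 o p` to `lift k 𝒳 o (p ++ [a])`. -/
def Moves (σ : hB.tabooTree.Strategy P) (p : List X) (a : X) (𝒳 : Set (List X))
    (o : Option (List X)) : Prop :=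
  σ.Follows (lift k 𝒳 o p) (tag k 𝒳 o p.length a)

theorem Moves.congr {σ : hB.tabooTree.Strategy P} {p : List X} {a : X} {𝒳 𝒳' : Set (List X)}
    {o o' : Option (List X)} (h : Moves σ p a 𝒳 o) (hX : k ≤ p.length → 𝒳 = 𝒳')
    (ho : k + 1 ≤ p.length → o = o') : Moves σ p a 𝒳' o' := by
  unfold Moves
  rw [← lift_congr (p := p) (fun h => hX (by omega)) (fun h => ho (by omega)),
    ← tag_congr (fun h => hX (by omega)) (fun h => ho (by omega))]
  exact h

theorem Moves.valid {σ : hB.tabooTree.Strategy P} {p : List X} {a : X} {𝒳 : Set (List X)}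
    {o : Option (List X)} (h : Moves σ p a 𝒳 o) :
    ∃ 𝒳' o', ValidLift T.toGameTree B (p ++ [a]) 𝒳' o' ∧
      lift k 𝒳 o (p ++ [a]) = lift k 𝒳' o' (p ++ [a]) := by
  obtain ⟨p', 𝒳', o', hv, he⟩ := h.mem
  rw [← lift_append] at he
  obtain rfl := eq_of_lift_eq he
  exact ⟨𝒳', o', hv, he⟩

/-- At a lifted position `σ` plays a tagged letter. The additional moves made at earlier levels are
kept; at level `k` the set `𝒳'`, and at level `k + 1` the option `o'`, is the choice of `σ`. -/
theorem exists_moves (σ : hB.tabooTree.Strategy P) (h : ValidLift T.toGameTree B p 𝒳 o)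
    (hp : ¬ T.Terminal p) (ho : o = none → p ∉ B) (ht : P.Turn p.length) :
    ∃ b 𝒳' o', ValidLift T.toGameTree B (p ++ [b]) 𝒳' o' ∧ Moves σ p b 𝒳' o' ∧
      (k < p.length → 𝒳' = 𝒳) ∧ (k + 1 < p.length → o' = o) := by
  have hnt : ¬ (liftTree T.toGameTree k B).Terminal (lift k 𝒳 o p) := by
    rw [hB.terminal_lift_iff h]
    tauto
  obtain ⟨y, hy⟩ := σ.exists_follows (q := lift k 𝒳 o p) ⟨p, 𝒳, o, h, rfl⟩ hnt
    (by rwa [length_lift])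
  obtain ⟨p', 𝒳', o', hv, he⟩ := hy.mem
  have hp' : p' = p ++ [y.1] := by
    have := congrArg (List.map Prod.fst) he
    rw [List.map_append, map_fst_lift, map_fst_lift] at this
    exact this.symm
  subst hp'
  rw [lift_append] at he
  obtain ⟨he1, he2⟩ := List.append_inj' he rfl
  refine ⟨y.1, 𝒳', o', hv, ?_, fun hk => (set_eq_of_lift_eq he1 hk).symm,
    fun hk => (option_eq_of_lift_eq he1 hk).symm⟩
  unfold Moves
  rw [← he1, ← List.singleton_inj.1 he2]
  exact hy

theorem moves_iff_of_agreeBelow {n : ℕ} {σ τ : hB.tabooTree.Strategy P}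
    (h : Strategy.AgreeBelow n σ τ) (hp : p.length < n) (a : X) :
    Moves σ p a 𝒳 o ↔ Moves τ p a 𝒳 o :=
  h.follows_iff (by rwa [length_lift]) _

/-- The set `𝒳` witnesses that `u ∈ B` can be picked in a play consistent with `σ` as far as the
moves at levels `k` and `k + 1` are concerned: these lead to the choice of `𝒳` and the pick of
`u`. -/
def Witness (σ : hB.tabooTree.Strategy P) (u : List X) (𝒳 : Set (List X)) : Prop :=
  u ∈ 𝒳 ∧ 𝒳 ⊆ B ∧ ∀ p a, p ++ [a] <+: u → (p.length = k ∨ p.length = k + 1) →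
    P.Turn p.length → Moves σ p a 𝒳 (some u)

/-- The elements of `B` that can be picked in a play consistent with `σ`. -/
def pickable (σ : hB.tabooTree.Strategy P) : Set (List X) := {u ∈ B | ∃ 𝒳, Witness σ u 𝒳}

/-- A fixed set witnessing that `u` can be picked. -/
noncomputable def pickSet (σ : hB.tabooTree.Strategy P) (u : List X) : Set (List X) :=
  Classical.epsilon (Witness σ u)

/-- The set `𝒳` on which a play through `p` consistent with `σ` is based as long as it has not
reached a pickable position. If the owner of `σ` moves at level `k`, it is the one named by `σ`;
otherwise it is the set of unpickable positions, so that `σ` has to accept it. -/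
def Accepts (σ : hB.tabooTree.Strategy P) (p : List X) (𝒳 : Set (List X)) : Prop :=
  (P.Turn k → ∃ q a, q ++ [a] <+: p ∧ q.length = k ∧ Moves σ q a 𝒳 none) ∧
    (¬ P.Turn k → 𝒳 = B \ pickable σ)

/-- The moves `a` at `p` that the image of `σ` may make. -/
def ImageMove (σ : hB.tabooTree.Strategy P) (p : List X) (a : X) : Prop :=
  (p.length ≤ k ∧ ∃ 𝒳, Moves σ p a 𝒳 none) ∨
  (k < p.length ∧ ∃ u ∈ pickable σ, u <+: p ∧ Moves σ p a (pickSet σ u) (some u)) ∨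
  (k < p.length ∧ (¬ ∃ u ∈ pickable σ, u <+: p) ∧ ∃ 𝒳, Accepts σ p 𝒳 ∧ Moves σ p a 𝒳 none)

/-- The image of a strategy in the given tree: before a pickable position is reached, it follows
`σ` against an opponent who accepts, and afterwards it follows `σ` with that position picked. -/
noncomputable def stratMap (σ : hB.tabooTree.Strategy P) : T.Strategy P :=
  Strategy.ofRel T.toGameTree P (ImageMove σ)

theorem imageMove_iff_of_agreeBelow {n : ℕ} {σ τ : hB.tabooTree.Strategy P}
    (h : Strategy.AgreeBelow n σ τ) (hp : p.length < n) (a : X) :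
    ImageMove σ p a ↔ ImageMove τ p a := by
  by_cases hk : p.length ≤ k
  · simp only [ImageMove, hk, not_lt.2 hk, false_and, or_false, true_and,
      moves_iff_of_agreeBelow h hp]
  · have hW : Witness σ = Witness τ := by
      funext u 𝒳
      refine propext (and_congr_right fun _ => and_congr_right fun _ => ?_)
      refine forall₂_congr fun q b => forall₃_congr fun _ hq _ => ?_
      exact moves_iff_of_agreeBelow h (by omega) b
    have hS : pickable σ = pickable τ := by simp only [pickable, hW]
    have hX : pickSet σ = pickSet τ := by funext u; simp only [pickSet, hW]
    have hA : Accepts σ p = Accepts τ p := by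
      funext 𝒳
      refine propext (and_congr (forall_congr' fun _ => exists₂_congr fun q b => ?_) (by rw [hS]))
      refine and_congr_right fun _ => and_congr_right fun hq => ?_
      exact moves_iff_of_agreeBelow h (by omega) b
    simp only [ImageMove, hk, false_and, false_or, hS, hX, hA, moves_iff_of_agreeBelow h hp]

theorem Accepts.unique {σ : hB.tabooTree.Strategy P} {𝒳' : Set (List X)}
    (h : Accepts σ p 𝒳) (h' : Accepts σ p 𝒳') : 𝒳 = 𝒳' := by
  by_cases hk : P.Turn k
  · obtain ⟨q, a, hq, hqk, hm⟩ := h.1 hk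
    obtain ⟨q', a', hq', hqk', hm'⟩ := h'.1 hk
    obtain ⟨rfl, -⟩ := List.append_inj' ((List.prefix_of_prefix_length_le hq hq'
      (by simp [hqk, hqk'])).eq_of_length (by simp [hqk, hqk'])) rfl
    unfold Moves at hm'
    rw [lift_congr (𝒳' := 𝒳) (o' := none) (by omega) (by omega)] at hm'
    have := Strategy.Follows.unique hm hm'
    simpa [tag, hqk] using congrArg (fun l : Letter X => l.2.1) this
  · rw [h.2 hk, h'.2 hk]

theorem witness_pickSet {σ : hB.tabooTree.Strategy P} {u : List X} (hu : u ∈ pickable σ) :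
    Witness σ u (pickSet σ u) :=
  Classical.epsilon_spec hu.2

/-- Up to level `k` the image of `σ` makes the moves of `σ`. -/
theorem exists_moves_of_follows {σ : hB.tabooTree.Strategy P} {a : X} (hp : p.length ≤ k)
    (h : (stratMap σ).Follows p a) : ∃ 𝒳, Moves σ p a 𝒳 none := by
  have hpB : ∀ v ∈ B, ¬ v <+: p := fun v hv hvp => by
    have := hB.le_length v hv
    have := hvp.length_le
    omega
  obtain ⟨⟨hpT, hnt, ht⟩, -⟩ := id h
  obtain ⟨b, 𝒳, o, hv, hm, -⟩ := exists_moves (o := none) σ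
    ⟨hpT, Set.empty_subset B, fun _ v hv hvp => absurd hvp (hpB v hv), by simp⟩ hnt
    (fun _ hp => hpB p hp (List.prefix_refl p)) ht
  have hm' : Moves σ p b 𝒳 none := hm.congr (fun _ => rfl) (by omega)
  rcases h.of_ofRel ⟨b, hv.1, Or.inl ⟨hp, 𝒳, hm'⟩⟩ with h | h | h
  · exact h.2
  · omega
  · omega

/-- A play of the given tree all of whose initial segments lift to positions consistent with `σ`
lifts to a play. -/
theorem exists_play_lift {σ : hB.tabooTree.Strategy P} {x : T.Play}
    (hv : ∀ p, FinInfSeq.HasInit p x.1 → ValidLift T.toGameTree B p 𝒳 o)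
    (hm : ∀ p a, FinInfSeq.HasInit (p ++ [a]) x.1 → P.Turn p.length → Moves σ p a 𝒳 o) :
    ∃ y : hB.tabooTree.Play, σ.ConsistentPlay y ∧ hB.posMap.playMap y = x.1 := by
  have key : ∀ q y p, FinInfSeq.HasInit p x.1 → q ++ [y] <+: lift k 𝒳 o p →
      P.Turn q.length → σ.Follows q y := by
    intro q y p hp hq ht
    obtain ⟨p', hp', he⟩ := exists_of_prefix_lift hq
    rcases List.eq_nil_or_concat' p' with rfl | ⟨r, a, rfl⟩
    · simpa using congrArg List.length he
    rw [lift_append] at he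
    obtain ⟨rfl, he2⟩ := List.append_inj' he rfl
    rw [List.singleton_inj.1 he2]
    exact hm r a (hp.of_prefix hp') (by rwa [length_lift] at ht)
  obtain ⟨s, hs⟩ := x
  cases s with
  | fin p =>
    have hp := hv p (List.prefix_refl p)
    refine ⟨⟨.fin (lift k 𝒳 o p), (hB.terminal_lift_iff hp).2 (Or.inl hs)⟩,
      Strategy.consistentPlay_of_follows fun q y hq => key q y p (List.prefix_refl p) hq, ?_⟩
    simp [PositionMap.playMap, posMap]
  | inf x =>
    have hx : ∀ n, FinInfSeq.HasInit (initSeg x n) (.inf x) := fun n => by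
      simp [FinInfSeq.HasInit]
    let y : hB.tabooTree.Branch := ⟨fun i => tag k 𝒳 o i (x i), fun n => by
      rw [initSeg_tag]
      exact ⟨_, _, _, hv _ (hx n), rfl⟩⟩
    refine ⟨y.toPlay, Strategy.consistentPlay_of_follows fun q z hq => ?_, ?_⟩
    · refine key q z (initSeg x (q ++ [z]).length) (hx _) ?_
      rw [← initSeg_tag]
      exact ⟨[], (List.append_nil _).trans hq⟩
    · change FinInfSeq.inf (hB.posMap.branchMap y).1 = .inf x
      congr 1
      refine initSeg_injective fun n => ?_
      rw [PositionMap.initSeg_branchMap]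
      change List.map Prod.fst (initSeg _ n) = _
      rw [initSeg_tag, map_fst_lift]

/-- If a play consistent with the image of `σ` reaches a pickable position `u`, then it lifts to a
play in which `u` is picked. -/
theorem exists_lift_of_pickable {σ : hB.tabooTree.Strategy P} {x : T.Play}
    (hx : (stratMap σ).ConsistentPlay x) {u : List X} (hu : u ∈ pickable σ)
    (hux : FinInfSeq.HasInit u x.1) :
    ∃ y : hB.tabooTree.Play, σ.ConsistentPlay y ∧ hB.posMap.playMap y = x.1 := by
  obtain ⟨huX, hXB, hW⟩ := witness_pickSet hu
  have hlu := hB.le_length u hu.1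
  have hv : ∀ p, FinInfSeq.HasInit p x.1 →
      ValidLift T.toGameTree B p (pickSet σ u) (some u) := by
    intro p hp
    refine ⟨x.mem_of_hasInit hp, hXB, by simp, ?_⟩
    rintro _ ⟨⟩
    refine ⟨huX, ?_⟩
    rcases le_total u.length p.length with h | h
    · exact Or.inl (hux.prefix_of_length_le hp h)
    · exact Or.inr (hp.prefix_of_length_le hux h)
  refine exists_play_lift hv fun p a hpa ht => ?_
  have hf := hx.follows hpa ht
  have hp := hpa.of_prefix (List.prefix_append p [a])
  rcases lt_or_ge p.length k with hk | hk
  · obtain ⟨𝒳, h𝒳⟩ := exists_moves_of_follows hk.le hf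
    exact h𝒳.congr (by omega) (by omega)
  have hpu : p.length < u.length → p ++ [a] <+: u := fun h =>
    hpa.prefix_of_length_le hux (by simpa using h)
  rcases lt_or_ge p.length (k + 2) with hk2 | hk2
  · exact hW p a (hpu (by omega)) (by omega) ht
  obtain ⟨b, 𝒳, o, hvb, hm, h1, h2⟩ := exists_moves σ (hv p hp)
    (not_terminal_of_append (x.mem_of_hasInit hpa)) (by simp) ht
  obtain rfl := h1 (by omega)
  obtain rfl := h2 (by omega)
  rcases lt_or_ge p.length u.length with hlt | hge
  · -- Before `u` is reached, the only legal move is the one towards `u`.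
    have hb : p ++ [b] <+: u := by
      rcases (hvb.2.2.2 u rfl).2 with h | h
      · exact List.prefix_of_prefix_length_le (List.prefix_refl _) h (by simpa using hlt)
      · exact h
    have := (List.prefix_of_prefix_length_le hb (hpu hlt) (by simp)).eq_of_length (by simp)
    simp only [List.append_cancel_left_eq, List.cons.injEq, and_true] at this
    exact this ▸ hm
  · have hup := hux.prefix_of_length_le hp hge
    rcases hf.of_ofRel ⟨b, hvb.1, Or.inr (Or.inl ⟨by omega, u, hu, hup, hm⟩)⟩ with h | h | h
    · omega
    · obtain ⟨-, u', hu', hup', hm'⟩ := h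
      rwa [hB.eq_of_prefix hu'.1 hu.1 hup' hup] at hm'
    · exact absurd ⟨u, hu, hup⟩ h.2.1

/-- All initial segments beyond level `k` of a play consistent with the image of `σ` are based on
the same set. -/
theorem exists_accepts {σ : hB.tabooTree.Strategy P} {x : T.Play}
    (hx : (stratMap σ).ConsistentPlay x) :
    ∃ 𝒳 ⊆ B, ∀ p, FinInfSeq.HasInit p x.1 → k < p.length → Accepts σ p 𝒳 := by
  by_cases hk : P.Turn k
  · by_cases hlong : ∃ p, FinInfSeq.HasInit p x.1 ∧ k < p.length
    · obtain ⟨r, hr, hrk⟩ := hlong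
      have hq : (r.take (k + 1)).length = k + 1 := by simp; omega
      obtain ⟨q, a, hqa⟩ := List.eq_nil_or_concat' (r.take (k + 1)) |>.resolve_left (by
        rintro h; simp [h] at hq)
      rw [hqa] at hq
      have hqk : q.length = k := by simpa using hq
      have hqx : FinInfSeq.HasInit (q ++ [a]) x.1 := hr.of_prefix (hqa ▸ List.take_prefix _ _)
      obtain ⟨𝒳, hm⟩ := exists_moves_of_follows hqk.le (hx.follows hqx (by rwa [hqk]))
      refine ⟨𝒳, ?_, fun p hp hpk => ⟨fun _ => ⟨q, a, ?_, hqk, hm⟩, fun h => absurd hk h⟩⟩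
      · obtain ⟨𝒳', o', hv, he⟩ := hm.valid
        rw [set_eq_of_lift_eq he (by simp [hqk])]
        exact hv.2.1
      · exact hqx.prefix_of_length_le hp (by simp; omega)
    · push Not at hlong
      exact ⟨∅, Set.empty_subset B, fun p hp hpk => absurd hpk (not_lt.2 (hlong p hp))⟩
  · exact ⟨B \ pickable σ, Set.sdiff_subset, fun p _ _ => ⟨fun h => absurd h hk, fun _ => rfl⟩⟩

/-- If a play consistent with the image of `σ` reaches no pickable position, then before it reaches
`B` it is the image of a play consistent with `σ` in which the opponent accepts. -/
theorem moves_of_not_pickable {σ : hB.tabooTree.Strategy P} {x : T.Play}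
    (hx : (stratMap σ).ConsistentPlay x)
    (hS : ∀ u ∈ pickable σ, ¬ FinInfSeq.HasInit u x.1) (hXB : 𝒳 ⊆ B)
    (hA : ∀ p, FinInfSeq.HasInit p x.1 → k < p.length → Accepts σ p 𝒳)
    {p : List X} {a : X} (hpa : FinInfSeq.HasInit (p ++ [a]) x.1) (ht : P.Turn p.length)
    (hpB : ∀ v ∈ B, ¬ v <+: p) : Moves σ p a 𝒳 none := by
  have hf := hx.follows hpa ht
  have hp := hpa.of_prefix (List.prefix_append p [a])
  rcases lt_trichotomy p.length k with hk | hk | hk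
  · obtain ⟨𝒳', h𝒳⟩ := exists_moves_of_follows hk.le hf
    exact h𝒳.congr (by omega) (by omega)
  · obtain ⟨q, b, hq, hqk, hm⟩ := (hA _ hpa (by simp [hk])).1 (hk ▸ ht)
    have he := hq.eq_of_length (by simp [hk, hqk])
    obtain ⟨rfl, he2⟩ := List.append_inj' he rfl
    rwa [List.singleton_inj.1 he2] at hm
  · have hAp := hA p hp hk
    obtain ⟨b, 𝒳', o, hvb, hm, h1, h2⟩ := exists_moves (o := none) σ
      ⟨x.mem_of_hasInit hp, hXB, fun _ v hv hvp => absurd hvp (hpB v hv), by simp⟩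
      (not_terminal_of_append (x.mem_of_hasInit hpa))
      (fun _ h => hpB p h (List.prefix_refl p)) ht
    obtain rfl := h1 hk
    -- At level `k + 1` the strategy `σ` cannot pick any element of the set of unpickable positions.
    have ho : o = none := by
      by_cases hk1 : p.length = k + 1
      · rw [hk1, Player.turn_succ_iff] at ht
        cases o with
        | none => rfl
        | some u =>
          exfalso
          obtain ⟨hu, hup⟩ := hvb.2.2.2 u rfl
          have huB := hXB hu
          have hlu := hB.le_length u huB
          have hpu : p ++ [b] <+: u := by
            rcases hup with h | h
            · exact List.prefix_of_prefix_length_le (List.prefix_refl _) h (by simp; omega)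
            · exact h
          have hu' := hAp.2 ht ▸ hu
          refine hu'.2 ⟨huB, 𝒳', hu, hXB, fun q c hq hqk hqt => ?_⟩
          rcases hqk with hqk | hqk
          · exact absurd (hqk ▸ hqt) ht
          · have he := (List.prefix_of_prefix_length_le hq hpu
              (by simp [hqk, hk1])).eq_of_length (by simp [hqk, hk1])
            obtain ⟨rfl, he2⟩ := List.append_inj' he rfl
            rwa [List.singleton_inj.1 he2]
      · exact h2 (by omega)
    subst ho
    have hSp : ¬ ∃ u ∈ pickable σ, u <+: p := fun ⟨u, hu, hup⟩ => hS u hu (hp.of_prefix hup)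
    rcases hf.of_ofRel ⟨b, hvb.1, Or.inr (Or.inr ⟨hk, hSp, 𝒳', hAp, hm⟩)⟩ with h | h | h
    · omega
    · obtain ⟨-, u, hu, hup, -⟩ := h
      exact absurd ⟨u, hu, hup⟩ hSp
    · obtain ⟨-, -, 𝒳'', hA', hm'⟩ := h
      rwa [hA'.unique hAp] at hm'

/-- If a play consistent with the image of `σ` reaches no pickable position but reaches `v ∈ B`,
then `v` lifts to a play consistent with `σ` that is taboo for the owner of `σ`. -/
theorem exists_taboo_lift {σ : hB.tabooTree.Strategy P} {x : T.Play}
    (hS : ∀ u ∈ pickable σ, ¬ FinInfSeq.HasInit u x.1) (hXB : 𝒳 ⊆ B)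
    (hA : ∀ p, FinInfSeq.HasInit p x.1 → k < p.length → Accepts σ p 𝒳)
    {v : List X} (hv : v ∈ B) (hvx : FinInfSeq.HasInit v x.1)
    (hm : ∀ p a, p ++ [a] <+: v → P.Turn p.length → Moves σ p a 𝒳 none) :
    ∃ y : hB.tabooTree.Play, σ.ConsistentPlay y ∧ (hB.posMap.playMap y).Sub x.1 ∧
      hB.tabooTree.IsTabooFor P y := by
  have hlv := hB.le_length v hv
  have hval : ValidLift T.toGameTree B v 𝒳 none :=
    ⟨hB.mem v hv, hXB, fun _ w hw hwv => hB.antichain w hw v hv hwv, by simp⟩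
  have hAv := hA v hvx (by omega)
  have hvS : v ∉ pickable σ := fun h => hS v h hvx
  refine ⟨⟨.fin (lift k 𝒳 none v), (hB.terminal_lift_iff hval).2 (Or.inr ⟨rfl, hv⟩)⟩,
    Strategy.consistentPlay_of_follows fun q y hq ht => ?_, ?_,
    ⟨_, ⟨v, 𝒳, none, hval, rfl, Or.inr ⟨rfl, hv, ?_⟩⟩, rfl⟩⟩
  · obtain ⟨p', hp', he⟩ := exists_of_prefix_lift hq
    rcases List.eq_nil_or_concat' p' with rfl | ⟨r, a, rfl⟩
    · simpa using congrArg List.length he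
    rw [lift_append] at he
    obtain ⟨rfl, he2⟩ := List.append_inj' he rfl
    rw [List.singleton_inj.1 he2]
    exact hm r a hp' (by rwa [length_lift] at ht)
  · refine FinInfSeq.fin_sub_iff.2 ?_
    change FinInfSeq.HasInit (List.map Prod.fst _) _
    rwa [map_fst_lift]
  · by_cases hk : P.Turn k
    · refine iff_of_true hk fun hvX => hvS ⟨hv, 𝒳, hvX, hXB, fun p a hpa hpk ht => ?_⟩
      rcases hpk with hpk | hpk
      · exact (hm p a hpa ht).congr (fun _ => rfl) (by omega)
      · rw [hpk, Player.turn_succ_iff] at ht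
        exact absurd hk ht
    · refine iff_of_false hk (not_not.2 ?_)
      rw [hAv.2 hk]
      exact ⟨hv, hvS⟩

variable (hB) in
/-- The covering of `T` by the tree with the additional moves. -/
noncomputable def cov : Cov hB.tabooTree T where
  posMap := hB.posMap
  stratMap _ σ := stratMap σ
  stratMap_local _ n _ _ h p hp :=
    Strategy.ofRel_congr fun a => imageMove_iff_of_agreeBelow h hp a
  lifting P σ x hx := by
    by_cases hS : ∃ u ∈ pickable σ, FinInfSeq.HasInit u x.1
    · obtain ⟨u, hu, hux⟩ := hS
      obtain ⟨y, hy, hyx⟩ := exists_lift_of_pickable hx hu hux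
      exact ⟨y, hy, hyx ▸ FinInfSeq.Sub.refl _, Or.inl hyx⟩
    push Not at hS
    obtain ⟨𝒳, hXB, hA⟩ := exists_accepts hx
    by_cases hv : ∃ v ∈ B, FinInfSeq.HasInit v x.1
    · obtain ⟨v, hv, hvx⟩ := hv
      obtain ⟨y, hy, hyx, hyt⟩ := exists_taboo_lift hS hXB hA hv hvx fun p a hpa ht =>
        moves_of_not_pickable hx hS hXB hA (hvx.of_prefix hpa) ht fun w hw hwp => by
          have hwv := hwp.trans ((List.prefix_append p [a]).trans hpa)
          obtain rfl := hB.antichain w hw v hv hwv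
          have h1 := hwp.length_le
          have h2 := hpa.length_le
          simp at h2
          omega
      exact ⟨y, hy, hyx, Or.inr hyt⟩
    · push Not at hv
      obtain ⟨y, hy, hyx⟩ := exists_play_lift (σ := σ) (x := x) (𝒳 := 𝒳) (o := none)
        (fun p hp => ⟨x.mem_of_hasInit hp, hXB,
          fun _ w hw hwp => absurd (hp.of_prefix hwp) (hv w hw), by simp⟩)
        (fun p a hpa ht => moves_of_not_pickable hx hS hXB hA hpa ht fun w hw hwp =>
          hv w hw (hpa.of_prefix (hwp.trans (List.prefix_append p [a]))))
      exact ⟨y, hy, hyx ▸ FinInfSeq.Sub.refl _, Or.inl hyx⟩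

variable (hB) in
theorem isK_cov : hB.cov.IsK (plain X) k where
  map_posMap q hq := by
    obtain ⟨p, 𝒳, o, h, he⟩ := q.2
    change (q.1.map Prod.fst).map _ = _
    rw [he, length_lift] at hq
    rw [he, map_fst_lift, lift_eq_map hq]
  map_mem p hp hk := by
    refine ⟨p, ∅, none, ⟨hp, Set.empty_subset B, fun _ v hv hvp => ?_, by simp⟩,
      (lift_eq_map hk).symm⟩
    have := hB.le_length v hv
    have := hvp.length_le
    omega
  taboo_posMap P q hq hqt := by
    obtain ⟨p, 𝒳, o, h, he, ht⟩ := hqt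
    change q.1.map Prod.fst ∈ _
    rw [he, length_lift] at hq
    rw [he, map_fst_lift]
    rcases ht with ht | ⟨-, hpB, -⟩
    · exact ht
    · have := hB.le_length p hpB
      omega
  follows P σ p a hp hf := by
    obtain ⟨𝒳, hm⟩ := exists_moves_of_follows hp.le hf
    unfold Moves at hm
    rwa [lift_eq_map hp.le, tag_eq_plain hp] at hm

variable (hB) in
/-- Whether a branch of the covering tree passes `B` is decided at level `k + 1`. -/
theorem branchMap_mem_iff (y : hB.tabooTree.Branch) :
    (∃ n, initSeg (hB.posMap.branchMap y).1 n ∈ B) ↔ (y.1 (k + 1)).2.2 ≠ none := by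
  have key : ∀ n, k + 2 ≤ n → ∃ 𝒳, ValidLift T.toGameTree B
      (initSeg (hB.posMap.branchMap y).1 n) 𝒳 (y.1 (k + 1)).2.2 := by
    intro n hn
    obtain ⟨p, 𝒳, o, h, he⟩ := y.2 n
    have hp : initSeg (hB.posMap.branchMap y).1 n = p := by
      rw [PositionMap.initSeg_branchMap]
      change (initSeg y.1 n).map Prod.fst = p
      rw [he, map_fst_lift]
    have hpl : n = p.length := by simpa using congrArg List.length he
    have ho : (y.1 (k + 1)).2.2 = o := by
      have := List.getElem_of_eq he (i := k + 1) (by simp; omega)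
      simp only [initSeg, lift, List.getElem_map, List.getElem_range, List.getElem_mapIdx, tag,
        if_true] at this
      rw [this]
    exact ⟨𝒳, by rw [hp, ho]; exact h⟩
  constructor
  · rintro ⟨n, hn⟩ ho
    have hl := hB.le_length _ hn
    rw [length_initSeg] at hl
    obtain ⟨𝒳, hv⟩ := key (n + 1) (by omega)
    have := hv.2.2.1 ho _ hn (initSeg_prefix _ (by omega))
    simpa using congrArg List.length this
  · intro ho
    obtain ⟨u, hu⟩ := Option.ne_none_iff_exists'.1 ho
    obtain ⟨𝒳, hv⟩ := key (max u.length (k + 2)) (le_max_right _ _)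
    obtain ⟨huX, hup⟩ := hv.2.2.2 u hu
    have hup' : u <+: initSeg (hB.posMap.branchMap y).1 (max u.length (k + 2)) := by
      rcases hup with h | h
      · exact h
      · exact List.prefix_of_prefix_length_le (List.prefix_refl _) h (by simp)
    exact ⟨u.length, eq_initSeg_of_prefix hup' ▸ hv.2.1 huX⟩

end Strategies

end IsBarrier

/-! ### Open sets are unravelable -/

section Open

variable {X : Type u}

/-- The shortest nonterminal positions of length at least `n` all of whose extensions to branches
belong to `O`. -/
def openBarrier (T : GameTree X) (n : ℕ) (O : Set T.Branch) : Set (List X) :=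
  {u | (u ∈ T.positions ∧ ¬ T.Terminal u ∧ n ≤ u.length ∧
      ∀ x : T.Branch, initSeg x.1 u.length = u → x ∈ O) ∧
    ∀ v, v <+: u → n ≤ v.length → (∀ x : T.Branch, initSeg x.1 v.length = v → x ∈ O) → v = u}

theorem isBarrier_openBarrier (T : GameTree X) (k : ℕ) (O : Set T.Branch) :
    IsBarrier T k (openBarrier T (k + 2) O) where
  mem _ h := h.1.1
  not_terminal _ h := h.1.2.1
  le_length _ h := h.1.2.2.1
  antichain u hu _ hv huv := hv.2 u huv hu.1.2.2.1 hu.1.2.2.2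

theorem mem_iff_exists_mem_openBarrier {T : GameTree X} {n : ℕ} {O : Set T.Branch}
    (hO : IsOpen O) (x : T.Branch) : x ∈ O ↔ ∃ m, initSeg x.1 m ∈ openBarrier T n O := by
  constructor
  · intro hx
    obtain ⟨m, hm⟩ := GameTree.isOpen_branch_iff.1 hO x hx
    have hex : ∃ l, n ≤ l ∧ ∀ y : T.Branch, initSeg y.1 l = initSeg x.1 l → y ∈ O := by
      refine ⟨max n m, le_max_left _ _, fun y hy => hm y ?_⟩
      rw [← take_initSeg y.1 (le_max_right n m), hy, take_initSeg _ (le_max_right n m)]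
    classical
    obtain ⟨h1, h2⟩ := Nat.find_spec hex
    refine ⟨Nat.find hex, ⟨x.2 _, ?_, by simpa using h1, by simpa using h2⟩, fun v hv hvn hvO => ?_⟩
    · have := x.2 (Nat.find hex + 1)
      rw [initSeg_succ] at this
      exact GameTree.not_terminal_of_append this
    · have hve := eq_initSeg_of_prefix hv
      have hmin : Nat.find hex ≤ v.length := Nat.find_min' hex ⟨hvn, by rwa [← hve]⟩
      exact hv.eq_of_length_le (by simpa using hmin)
  · rintro ⟨m, hm⟩
    exact hm.1.2.2.2 x (by simp)

theorem unravelable_of_isOpen (T : TabooTree X) (k : ℕ) {O : Set T.Branch} (hO : IsOpen O) :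
    Unravelable T k O := by
  have hB := isBarrier_openBarrier T.toGameTree k O
  refine ⟨Letter X, hB.tabooTree, hB.cov, plain X, hB.isK_cov, ?_⟩
  have hpre : hB.cov.posMap.branchMap ⁻¹' O = {y | (y.1 (k + 1)).2.2 ≠ none} := by
    ext y
    exact (mem_iff_exists_mem_openBarrier hO _).trans (hB.branchMap_mem_iff y)
  have hlet : ∀ y z : hB.tabooTree.Branch, initSeg z.1 (k + 2) = initSeg y.1 (k + 2) →
      z.1 (k + 1) = y.1 (k + 1) := by
    intro y z h
    rw [initSeg_succ z.1 (k + 1), initSeg_succ y.1 (k + 1)] at h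
    simpa using (List.append_inj' h rfl).2
  rw [hpre]
  constructor
  · rw [← isOpen_compl_iff, GameTree.isOpen_branch_iff]
    exact fun y hy => ⟨k + 2, fun z hz => by simpa [hlet y z hz] using hy⟩
  · rw [GameTree.isOpen_branch_iff]
    exact fun y hy => ⟨k + 2, fun z hz => by simpa [hlet y z hz] using hy⟩

end Open

/-! ### Inverse limits of coverings -/

namespace InverseLimit

open GameTree

variable {Y : ℕ → Type u} {T : ∀ n, TabooTree (Y n)}

/-- The `n`-th coordinate of a finite sequence of threads. -/
def proj (n : ℕ) (q : List (∀ n, Y n)) : List (Y n) := q.map fun z => z n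

@[simp] theorem length_proj (n : ℕ) (q : List (∀ n, Y n)) : (proj n q).length = q.length := by
  simp [proj]

theorem proj_append (n : ℕ) (q : List (∀ n, Y n)) (z : ∀ n, Y n) :
    proj n (q ++ [z]) = proj n q ++ [z n] := by
  simp [proj]

theorem proj_prefix {q q' : List (∀ n, Y n)} (h : q <+: q') (n : ℕ) : proj n q <+: proj n q' :=
  h.map _

theorem eq_of_proj_eq {q q' : List (∀ n, Y n)} (h : ∀ n, proj n q = proj n q') : q = q' := by
  have hl : q.length = q'.length := by simpa using congrArg List.length (h 0)
  refine List.ext_getElem hl fun i h1 h2 => funext fun n => ?_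
  have := List.getElem_of_eq (h n) (i := i) (by simpa using h1)
  simpa [proj] using this

/-- A sequence of positions, each of which is mapped to the preceding one. -/
def IsThread (C : ∀ n, Cov (T (n + 1)) (T n)) (r : ∀ n, (T n).Pos) : Prop :=
  ∀ n, (C n).posMap.toFun (r (n + 1)) = r n

/-- Every position `p` of length at most `k + m` of the `m`-th tree belongs to a thread: below `m`
the thread consists of the images of `p`, and above `m` of `p` itself, up to relabelling. -/
theorem exists_thread (m : ℕ) : ∀ {Y : ℕ → Type u} {T : ∀ n, TabooTree (Y n)}
    {C : ∀ n, Cov (T (n + 1)) (T n)} {ι : ∀ n, Y n ↪ Y (n + 1)} {k : ℕ}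
    (_ : ∀ n, (C n).IsK (ι n) (k + n)) (p : (T m).Pos), p.1.length ≤ k + m →
    ∃ r, IsThread C r ∧ r m = p := by
  induction m with
  | zero =>
    intro Y T C ι k hC p hp
    let s : ∀ n, {p : (T n).Pos // p.1.length ≤ k} := fun n =>
      Nat.rec ⟨p, hp⟩ (fun n p => ⟨⟨p.1.1.map (ι n),
        (hC n).map_mem _ p.1.2 (p.2.trans (Nat.le_add_right _ _))⟩, by simpa using p.2⟩) n
    refine ⟨fun n => (s n).1, fun n => Subtype.ext ?_, rfl⟩
    exact (hC n).posMap_map (s n).1.2 ((s n).2.trans (Nat.le_add_right _ _))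
  | succ m ih =>
    intro Y T C ι k hC p hp
    have hC' : ∀ n, (C (n + 1)).IsK (ι (n + 1)) (k + 1 + n) := fun n => by
      have := hC (n + 1)
      rwa [show k + (n + 1) = k + 1 + n by omega] at this
    obtain ⟨r, hr, hrm⟩ := ih (T := fun n => T (n + 1)) (C := fun n => C (n + 1))
      (ι := fun n => ι (n + 1)) hC' p (by omega)
    refine ⟨fun n => Nat.casesOn n ((C 0).posMap.toFun (r 0)) r, fun n => ?_, hrm⟩
    cases n with
    | zero => rfl
    | succ n => exact hr n

theorem IsThread.length_eq {C : ∀ n, Cov (T (n + 1)) (T n)} {r : ∀ n, (T n).Pos}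
    (h : IsThread C r) (n : ℕ) : (r n).1.length = (r 0).1.length := by
  induction n with
  | zero => rfl
  | succ n ih => rw [← ih, ← h n, (C n).posMap.length_eq]

/-- The inverse limit of a sequence of game trees: its letters are sequences of letters of the
given trees, and its positions are the threads, read as finite sequences of such letters. -/
def gameTree (C : ∀ n, Cov (T (n + 1)) (T n)) : GameTree (∀ n, Y n) where
  positions := {q | ∃ r : ∀ n, (T n).Pos, IsThread C r ∧ ∀ n, (r n).1 = proj n q}
  nonempty := ⟨[], fun n => ⟨[], (T n).nil_mem⟩, fun n => Subtype.ext
    (List.length_eq_zero_iff.1 ((C n).posMap.length_eq _)), fun _ => rfl⟩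
  closed := by
    rintro q' q ⟨r, hr, hrq⟩ hq
    have hmem : ∀ n, proj n q' ∈ (T n).positions := fun n =>
      (T n).closed _ _ (r n).2 (hrq n ▸ proj_prefix hq n)
    refine ⟨fun n => ⟨proj n q', hmem n⟩, fun n => Subtype.ext ?_, fun _ => rfl⟩
    have h1 := (C n).posMap.mono ⟨proj (n + 1) q', hmem (n + 1)⟩ (r (n + 1))
      (hrq (n + 1) ▸ proj_prefix hq (n + 1))
    rw [hr n, hrq n] at h1
    refine (List.prefix_of_prefix_length_le h1 (proj_prefix hq n) ?_).eq_of_length ?_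
    · rw [(C n).posMap.length_eq]; simp
    · rw [(C n).posMap.length_eq]; simp

variable {C : ∀ n, Cov (T (n + 1)) (T n)}

theorem proj_mem {q : List (∀ n, Y n)} (h : q ∈ (gameTree C).positions) (n : ℕ) :
    proj n q ∈ (T n).positions := by
  obtain ⟨r, -, hrq⟩ := h
  exact hrq n ▸ (r n).2

theorem posMap_proj {q : List (∀ n, Y n)} (h : q ∈ (gameTree C).positions) (n : ℕ) :
    (C n).posMap.toFun ⟨proj (n + 1) q, proj_mem h (n + 1)⟩ = ⟨proj n q, proj_mem h n⟩ := by
  obtain ⟨r, hr, hrq⟩ := id h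
  have h1 : ∀ n, r n = ⟨proj n q, proj_mem h n⟩ := fun n => Subtype.ext (hrq n)
  rw [← h1, ← h1, hr n]

theorem exists_of_thread {r : ∀ n, (T n).Pos} (hr : IsThread C r) :
    ∃ q ∈ (gameTree C).positions, ∀ n, proj n q = (r n).1 := by
  have hl := hr.length_eq
  let q : List (∀ n, Y n) := List.ofFn fun (i : Fin (r 0).1.length) n =>
    (r n).1[i.1]'(by rw [hl n]; exact i.2)
  have hq : ∀ n, proj n q = (r n).1 := fun n => by
    apply List.ext_getElem
    · simp [q, hl n]
    · intro i h1 h2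
      simp [q, proj]
  exact ⟨q, ⟨r, hr, fun n => (hq n).symm⟩, hq⟩

theorem proj_mem_taboo {P : Player} {q : List (∀ n, Y n)} (hq : q ∈ (gameTree C).positions)
    {n m : ℕ} (hnm : n ≤ m) (h : proj n q ∈ (T n).taboo P) : proj m q ∈ (T m).taboo P := by
  induction m, hnm using Nat.le_induction with
  | base => exact h
  | succ m _ ih =>
    refine (C m).posMap.taboo P ⟨_, proj_mem hq (m + 1)⟩ ?_
    rwa [posMap_proj hq]

theorem terminal_of_terminal_proj {q : List (∀ n, Y n)} (hq : q ∈ (gameTree C).positions) {n : ℕ}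
    (h : (T n).Terminal (proj n q)) : (gameTree C).Terminal q := by
  refine ⟨hq, ?_⟩
  rintro ⟨q', hq', hpre, hne⟩
  have := h.eq_of_prefix (proj_mem hq' n) (proj_prefix hpre n)
  exact hne (hpre.eq_of_length (by simpa using congrArg List.length this))

variable {ι : ∀ n, Y n ↪ Y (n + 1)} {k : ℕ}

section

variable (hC : ∀ n, (C n).IsK (ι n) (k + n))

include hC

/-- The limit tree agrees with the `m`-th tree up to level `k + m`. -/
theorem exists_proj_eq {m : ℕ} {p : List (Y m)} (hp : p ∈ (T m).positions)
    (hk : p.length ≤ k + m) : ∃ q ∈ (gameTree C).positions, proj m q = p := by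
  obtain ⟨r, hr, hrm⟩ := exists_thread m hC ⟨p, hp⟩ hk
  obtain ⟨q, hq, hqr⟩ := exists_of_thread hr
  exact ⟨q, hq, by rw [hqr, hrm]⟩

theorem eq_of_proj_eq_of_length_le {m : ℕ} {q q' : List (∀ n, Y n)}
    (hq : q ∈ (gameTree C).positions) (hq' : q' ∈ (gameTree C).positions)
    (hk : q.length ≤ k + m) (h : proj m q = proj m q') : q = q' := by
  have hup : ∀ n, m ≤ n → proj n q = proj n q' := by
    intro n hn
    induction n, hn using Nat.le_induction with
    | base => exact h
    | succ n hn ih =>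
      have := (hC n).injective (q := ⟨_, proj_mem hq (n + 1)⟩) (r := ⟨_, proj_mem hq' (n + 1)⟩)
        (by simp; omega)
        (by rw [posMap_proj hq, posMap_proj hq']; exact ih)
      exact congrArg Subtype.val this
  have hdown : ∀ n, proj (n + 1) q = proj (n + 1) q' → proj n q = proj n q' := by
    intro n h
    have h1 := congrArg Subtype.val (posMap_proj hq n)
    have h2 := congrArg Subtype.val (posMap_proj hq' n)
    simp only [h] at h1
    exact h1.symm.trans h2
  refine eq_of_proj_eq fun n => ?_
  rcases le_total m n with hn | hn
  · exact hup n hn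
  · induction hn using Nat.decreasingInduction with
    | of_succ n _ ih => exact hdown n ih
    | self => exact h

theorem exists_append_mem {m : ℕ} {q : List (∀ n, Y n)} (hq : q ∈ (gameTree C).positions)
    {a : Y m} (ha : proj m q ++ [a] ∈ (T m).positions) (hk : q.length < k + m) :
    ∃ z, q ++ [z] ∈ (gameTree C).positions ∧ z m = a := by
  obtain ⟨q', hq', he⟩ := exists_proj_eq hC ha (by simp; omega)
  rcases List.eq_nil_or_concat' q' with rfl | ⟨q'', z, rfl⟩
  · simpa using congrArg List.length he
  rw [proj_append] at he
  obtain ⟨he1, he2⟩ := List.append_inj' he rfl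
  have := eq_of_proj_eq_of_length_le hC hq
    ((gameTree C).closed _ _ hq' (List.prefix_append _ _)) hk.le he1.symm
  subst this
  exact ⟨z, hq', List.singleton_inj.1 he2⟩

theorem terminal_proj {q : List (∀ n, Y n)} (h : (gameTree C).Terminal q) {m : ℕ}
    (hk : q.length < k + m) : (T m).Terminal (proj m q) := by
  by_contra hcon
  obtain ⟨a, ha⟩ := exists_move (proj_mem h.1 m) hcon
  obtain ⟨z, hz, -⟩ := exists_append_mem hC h.1 ha hk
  exact not_terminal_of_append hz h

end

/-- The inverse limit as a game tree with taboos: a terminal position is taboo if its coordinates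
are, from some point on. -/
def tree (hC : ∀ n, (C n).IsK (ι n) (k + n)) : TabooTree (∀ n, Y n) where
  toGameTree := gameTree C
  taboo P := {q | q ∈ (gameTree C).positions ∧ ∃ n, proj n q ∈ (T n).taboo P}
  taboo_disjoint := by
    rw [Set.disjoint_left]
    rintro q ⟨hq, n, hn⟩ ⟨-, m, hm⟩
    exact Set.disjoint_left.1 (T (max n m)).taboo_disjoint
      (proj_mem_taboo hq (le_max_left n m) hn) (proj_mem_taboo hq (le_max_right n m) hm)
  taboo_union := by
    ext q
    constructor
    · rintro (⟨hq, n, hn⟩ | ⟨hq, n, hn⟩)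
      all_goals exact terminal_of_terminal_proj hq (TabooTree.terminal_of_mem_taboo hn)
    · intro h
      obtain ⟨P, hP⟩ := TabooTree.exists_mem_taboo
        (terminal_proj hC h (m := q.length + 1) (by omega))
      cases P
      · exact Or.inl ⟨h.1, _, hP⟩
      · exact Or.inr ⟨h.1, _, hP⟩

/-- The projection of the inverse limit to the `n`-th tree. -/
def projMap (hC : ∀ n, (C n).IsK (ι n) (k + n)) (n : ℕ) : PositionMap (tree hC) (T n) where
  toFun q := ⟨proj n q.1, proj_mem q.2 n⟩
  mono _ _ h := proj_prefix h n
  length_eq _ := length_proj n _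
  taboo _ q h := ⟨q.2, n, h⟩

theorem comp_projMap (hC : ∀ n, (C n).IsK (ι n) (k + n)) (n : ℕ) :
    (C n).posMap.comp (projMap hC (n + 1)) = projMap hC n := by
  have : ((C n).posMap.comp (projMap hC (n + 1))).toFun = (projMap hC n).toFun :=
    funext fun q => posMap_proj q.2 n
  cases h : (C n).posMap.comp (projMap hC (n + 1))
  cases h' : projMap hC n
  simp_all

/-! ### Strategies in the inverse limit -/

section Strategies

variable {hC : ∀ n, (C n).IsK (ι n) (k + n)} {P : Player}

/-- A strategy in the `n`-th tree that makes the same moves as `σ` at positions of length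
`< k + n`, where the trees agree. At longer positions it is arbitrary, but still depends only on the
moves of `σ` at positions of the same length. -/
noncomputable def base (σ : (tree hC).Strategy P) (n : ℕ) : (T n).Strategy P :=
  Strategy.ofRel (T n).toGameTree P fun p a => ∃ q z, proj n q = p ∧ z n = a ∧ σ.Follows q z

theorem base_follows {σ : (tree hC).Strategy P} {n : ℕ} {p : List (Y n)} {a : Y n}
    (hp : p.length < k + n) (h : (base σ n).Follows p a) :
    ∃ q z, proj n q = p ∧ z n = a ∧ σ.Follows q z := by
  obtain ⟨⟨hpT, hnt, ht⟩, -⟩ := id h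
  refine h.of_ofRel ?_
  obtain ⟨q, hq, rfl⟩ := exists_proj_eq hC hpT hp.le
  rw [length_proj] at ht hp
  obtain ⟨b, hb⟩ := exists_move hpT hnt
  obtain ⟨z, hz, -⟩ := exists_append_mem hC hq hb hp
  obtain ⟨y, hy⟩ := σ.exists_follows (q := q) hq (not_terminal_of_append hz) ht
  refine ⟨y n, ?_, q, y, rfl, rfl, hy⟩
  have := proj_mem hy.mem n
  rwa [proj_append] at this

/-- The `d`-th approximation to the image of `σ` in the `n`-th tree: the strategy `base σ (n + d)`
carried down along `d` coverings. It is final at positions of length `< k + n + d`. -/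
noncomputable def approx (σ : (tree hC).Strategy P) : ℕ → ∀ n, (T n).Strategy P
  | 0, n => base σ n
  | d + 1, n => (C n).stratMap P (approx σ d (n + 1))

/-- At positions of length `< k + n` the strategy map of the `n`-th covering preserves moves, so the
claim holds for `d = 0`; the locality of the strategy maps carries it from `d` to `d + 1`. -/
theorem approx_agreeBelow_succ (σ : (tree hC).Strategy P) (d : ℕ) : ∀ n,
    Strategy.AgreeBelow (k + n + d) (approx σ d n) (approx σ (d + 1) n) := by
  induction d with
  | zero =>
    intro n p hp
    have hp' : p.1.length < k + n := hp
    obtain ⟨q, z, hq, hz, hf⟩ := base_follows hp' ((base σ n).follows_move p)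
    have h := (hC n).follows P (base σ (n + 1)) p.1 _ hp'
      (((C n).stratMap P (base σ (n + 1))).follows_move p)
    obtain ⟨q', z', hq', hz', hf'⟩ := base_follows (by simp; omega) h
    set a := ((C n).stratMap P (base σ (n + 1))).move p
    have hpa : p.1 ++ [a] ∈ (T n).positions := ((C n).stratMap P (base σ (n + 1))).legal p
    have hmem := hf'.mem
    have h1 : proj n (q' ++ [z']) = p.1 ++ [a] := by
      have h2 : proj (n + 1) (q' ++ [z']) = (p.1 ++ [a]).map (ι n) := by
        rw [proj_append, hq', hz']; simp
      have h3 := congrArg Subtype.val (posMap_proj hmem n)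
      simp only [h2] at h3
      rw [← h3]
      exact (hC n).posMap_map hpa (by simp; omega)
    rw [proj_append] at h1
    obtain ⟨h4, h5⟩ := List.append_inj' h1 rfl
    have hqq : q = q' := eq_of_proj_eq_of_length_le hC hf.1.1 hf'.1.1
      (by rw [← length_proj n, hq]; omega) (hq.trans h4.symm)
    subst hqq
    obtain rfl := hf.unique hf'
    exact hz.symm.trans (List.singleton_inj.1 h5)
  | succ d ih =>
    intro n
    have := ih (n + 1)
    rw [show k + (n + 1) + d = k + n + (d + 1) by omega] at this
    exact (C n).stratMap_local P _ _ _ this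

theorem approx_agreeBelow (σ : (tree hC).Strategy P) (n : ℕ) {d e : ℕ} (h : d ≤ e) :
    Strategy.AgreeBelow (k + n + d) (approx σ d n) (approx σ e n) := by
  induction e, h using Nat.le_induction with
  | base => exact fun _ _ => rfl
  | succ e he ih =>
    exact fun p hp => (ih p hp).trans (approx_agreeBelow_succ σ e n p (by omega))

theorem approx_local {N : ℕ} {σ τ : (tree hC).Strategy P} (h : Strategy.AgreeBelow N σ τ)
    (d : ℕ) : ∀ n, Strategy.AgreeBelow N (approx σ d n) (approx τ d n) := by
  induction d with
  | zero =>
    intro n p hp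
    change (base σ n).move p = (base τ n).move p
    refine Strategy.ofRel_congr fun a => ?_
    refine exists₂_congr fun q z => and_congr_right fun hq => and_congr_right fun _ =>
      h.follows_iff ?_ z
    rwa [← length_proj n, hq]
  | succ d ih => exact fun n => (C n).stratMap_local P N _ _ (ih (n + 1))

/-- The image of `σ` in the `n`-th tree: the limit of the approximations. -/
noncomputable def image (σ : (tree hC).Strategy P) (n : ℕ) : (T n).Strategy P where
  move p := (approx σ (p.1.length + 1) n).move p
  legal p := (approx σ (p.1.length + 1) n).legal p

theorem image_agreeBelow (σ : (tree hC).Strategy P) (n d : ℕ) :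
    Strategy.AgreeBelow (k + n + d) (image σ n) (approx σ d n) := by
  intro p hp
  change (approx σ (p.1.length + 1) n).move p = _
  rcases le_total d (p.1.length + 1) with h | h
  · exact (approx_agreeBelow σ n h p hp).symm
  · exact approx_agreeBelow σ n h p (by omega)

theorem stratMap_image (σ : (tree hC).Strategy P) (n : ℕ) :
    (C n).stratMap P (image σ (n + 1)) = image σ n := by
  have : ((C n).stratMap P (image σ (n + 1))).move = (image σ n).move := by
    funext p
    rw [(C n).stratMap_local P _ _ _ (image_agreeBelow σ (n + 1) (p.1.length + 1)) p (by omega),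
      image_agreeBelow σ n (p.1.length + 2) p (by omega)]
    rfl
  cases h : (C n).stratMap P (image σ (n + 1))
  cases h' : image σ n
  simp_all

theorem image_follows {σ : (tree hC).Strategy P} {n : ℕ} {p : List (Y n)} {a : Y n}
    (hp : p.length < k + n) (h : (image σ n).Follows p a) :
    ∃ q z, proj n q = p ∧ z n = a ∧ σ.Follows q z :=
  base_follows hp (((image_agreeBelow σ n 0).follows_iff hp a).1 h)

/-- A move of the image of `σ` in the `m`-th tree at a position of length `< k + m` is a move
of `σ`. -/
theorem follows_of_image_follows {σ : (tree hC).Strategy P} {m : ℕ} {q : List (∀ n, Y n)}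
    {y : ∀ n, Y n} (hq : q ++ [y] ∈ (gameTree C).positions) (hk : q.length < k + m)
    (h : (image σ m).Follows (proj m q) (y m)) : σ.Follows q y := by
  obtain ⟨q', z, hq', hz, hf⟩ := image_follows (by simpa using hk) h
  have := eq_of_proj_eq_of_length_le hC hq hf.mem (m := m) (by simp; omega)
    (by rw [proj_append, proj_append, hq', hz])
  obtain ⟨rfl, h2⟩ := List.append_inj' this rfl
  rwa [List.singleton_inj.1 h2]

/-! ### Lifting plays to the inverse limit -/

/-- A sequence of successive lifts of plays consistent with the images of `σ`. -/
structure IsLiftSeq (σ : (tree hC).Strategy P) (x : ∀ n, (T n).Play) : Prop where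
  consistent : ∀ n, (image σ n).ConsistentPlay (x n)
  sub : ∀ n, ((C n).posMap.playMap (x (n + 1))).Sub (x n).1
  eq_or_taboo : ∀ n, (C n).posMap.playMap (x (n + 1)) = (x n).1 ∨
    (T (n + 1)).IsTabooFor P (x (n + 1))

theorem exists_isLiftSeq {σ : (tree hC).Strategy P} {x₀ : (T 0).Play}
    (h : (image σ 0).ConsistentPlay x₀) : ∃ x, IsLiftSeq σ x ∧ x 0 = x₀ := by
  have step : ∀ n (x : {x : (T n).Play // (image σ n).ConsistentPlay x}),
      ∃ y : {y : (T (n + 1)).Play // (image σ (n + 1)).ConsistentPlay y},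
        ((C n).posMap.playMap y.1).Sub x.1.1 ∧
        ((C n).posMap.playMap y.1 = x.1.1 ∨ (T (n + 1)).IsTabooFor P y.1) := by
    rintro n ⟨x, hx⟩
    obtain ⟨y, hy, h1, h2⟩ := (C n).lifting P (image σ (n + 1)) x (by rwa [stratMap_image])
    exact ⟨⟨y, hy⟩, h1, h2⟩
  choose next hnext using step
  let x : ∀ n, {x : (T n).Play // (image σ n).ConsistentPlay x} := fun n =>
    Nat.rec ⟨x₀, h⟩ (fun n x => next n x) n
  exact ⟨fun n => (x n).1, ⟨fun n => (x n).2, fun n => (hnext n (x n)).1,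
    fun n => (hnext n (x n)).2⟩, rfl⟩

/-- The lengths of finite lifts do not increase. -/
theorem IsLiftSeq.exists_eq_fin {σ : (tree hC).Strategy P} {x : ∀ n, (T n).Play}
    (hx : IsLiftSeq σ x) {m : ℕ} {p : List (Y m)} (hp : (x m).1 = .fin p) (d : ℕ) :
    ∃ p' : List (Y (m + d)), (x (m + d)).1 = .fin p' ∧ p'.length ≤ p.length := by
  induction d with
  | zero => exact ⟨p, hp, le_rfl⟩
  | succ d ih =>
    obtain ⟨p', hp', hl⟩ := ih
    have hsub := hx.sub (m + d)
    rw [hp'] at hsub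
    change ∃ p'' : List (Y (m + d + 1)), (x (m + d + 1)).1 = .fin p'' ∧ _
    rcases hxd : x (m + d + 1) with ⟨s, hs⟩
    rw [hxd] at hsub
    cases s with
    | fin r =>
      refine ⟨r, rfl, ?_⟩
      have h1 : _ <+: p' := FinInfSeq.fin_sub_iff.1 hsub
      have := h1.length_le
      rw [(C (m + d)).posMap.length_eq] at this
      exact this.trans hl
    | inf z =>
      let b : (T (m + d + 1)).Branch := ⟨z, hs⟩
      have h1 : initSeg ((C (m + d)).posMap.branchMap b).1 (p'.length + 1) <+: p' :=
        hsub _ (congrArg (initSeg _) (length_initSeg _ _).symm)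
      have := h1.length_le
      rw [length_initSeg] at this
      omega

/-- A finite lift of length at most `k + m` in the `m`-th tree comes from a play of the limit. -/
theorem IsLiftSeq.exists_lift_of_fin {σ : (tree hC).Strategy P} {x : ∀ n, (T n).Play}
    (hx : IsLiftSeq σ x) {m : ℕ} {p : List (Y m)} (hp : (x m).1 = .fin p)
    (hk : p.length ≤ k + m) :
    ∃ y : (tree hC).Play, σ.ConsistentPlay y ∧ ((projMap hC 0).playMap y).Sub (x 0).1 ∧
      ((projMap hC 0).playMap y = (x 0).1 ∨ (tree hC).IsTabooFor P y) := by
  have hpt : (T m).Terminal p := by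
    have := (x m).2
    rwa [hp] at this
  obtain ⟨q, hq, rfl⟩ := exists_proj_eq hC hpt.1 hk
  rw [length_proj] at hk
  have key : ∀ j ≤ m, (FinInfSeq.fin (proj j q)).Sub (x j).1 ∧
      (FinInfSeq.fin (proj j q) = (x j).1 ∨ proj m q ∈ (T m).taboo P) := by
    intro j hj
    induction hj using Nat.decreasingInduction with
    | self => exact ⟨hp ▸ FinInfSeq.Sub.refl _, Or.inl hp.symm⟩
    | of_succ j hj ih =>
      have hpos := congrArg Subtype.val (posMap_proj hq j)
      constructor
      · have := (C j).posMap.hasInit_playMap (p := ⟨_, proj_mem hq (j + 1)⟩)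
          (FinInfSeq.fin_sub_iff.1 ih.1)
        rw [hpos] at this
        exact FinInfSeq.fin_sub_iff.2 (hx.sub j _ this)
      · rcases ih.2 with h | h
        · rcases hx.eq_or_taboo j with h' | ⟨r, hr, h'⟩
          · left
            rw [← h', (C j).posMap.playMap_of_eq_fin (p := ⟨_, proj_mem hq (j + 1)⟩) h.symm, hpos]
          · right
            rw [← h, FinInfSeq.fin.injEq] at h'
            exact proj_mem_taboo hq hj (h' ▸ hr)
        · exact Or.inr h
  obtain ⟨h1, h2⟩ := key 0 (Nat.zero_le m)
  refine ⟨⟨.fin q, terminal_of_terminal_proj hq hpt⟩,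
    Strategy.consistentPlay_of_follows fun q₀ w hw ht => ?_, h1,
    h2.imp id fun h => ⟨q, ⟨hq, m, h⟩, rfl⟩⟩
  have hw' : q₀ ++ [w] <+: q := hw
  have hl := hw'.length_le
  rw [List.length_append, List.length_singleton] at hl
  refine follows_of_image_follows (m := m) ((gameTree C).closed _ _ hq hw') (by omega) ?_
  refine (hx.consistent m).follows ?_ (by simpa using ht)
  rw [hp, ← proj_append]
  exact proj_prefix hw' m

/-- If all lifts are infinite, then each is mapped to the preceding one, and together they form a
branch of the limit. -/
theorem IsLiftSeq.exists_lift_of_inf {σ : (tree hC).Strategy P} {x : ∀ n, (T n).Play}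
    (hx : IsLiftSeq σ x) (hinf : ∀ n p, (x n).1 ≠ .fin p) :
    ∃ y : (tree hC).Play, σ.ConsistentPlay y ∧ (projMap hC 0).playMap y = (x 0).1 := by
  have hex : ∀ n, ∃ z : (T n).Branch, z.toPlay = x n := by
    intro n
    rcases hxn : x n with ⟨s, hs⟩
    cases s with
    | fin p => exact absurd (congrArg Subtype.val hxn) (hinf n p)
    | inf z => exact ⟨⟨z, hs⟩, rfl⟩
  choose z hz using hex
  have hzC : ∀ n, (C n).posMap.branchMap (z (n + 1)) = z n := by
    intro n
    rcases hx.eq_or_taboo n with h | ⟨p, -, hp⟩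
    · rw [← hz, ← hz] at h
      exact Subtype.ext (FinInfSeq.inf.inj h)
    · exact absurd hp (hinf _ p)
  have hproj : ∀ n j, proj n (initSeg (fun i n => (z n).1 i) j) = initSeg (z n).1 j := by
    intro n j
    simp [proj, initSeg]
  let y : (tree hC).Branch := ⟨fun i n => (z n).1 i, fun j => by
    refine ⟨fun n => ⟨initSeg (z n).1 j, (z n).2 j⟩, fun n => Subtype.ext ?_,
      fun n => (hproj n j).symm⟩
    change ((C n).posMap.toFun ⟨initSeg (z (n + 1)).1 j, _⟩).1 = initSeg (z n).1 j
    rw [← hzC n, PositionMap.initSeg_branchMap]⟩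
  refine ⟨y.toPlay, Strategy.consistentPlay_of_follows fun q w hq ht => ?_, ?_⟩
  · have hmem := y.toPlay.mem_of_hasInit hq
    refine follows_of_image_follows (m := q.length + 1) hmem (by omega) ?_
    refine (hx.consistent _).follows ?_ (by simpa using ht)
    rw [← proj_append, ← hz]
    change _ = initSeg _ _
    rw [length_proj, ← hproj]
    exact congrArg (proj _) hq
  · rw [← hz]
    change FinInfSeq.inf ((projMap hC 0).branchMap y).1 = .inf (z 0).1
    congr 1
    refine initSeg_injective fun j => ?_
    rw [PositionMap.initSeg_branchMap]
    exact hproj 0 j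

end Strategies

/-! ### The limit covering -/

/-- The covering of the first tree by the inverse limit. -/
noncomputable def cov (hC : ∀ n, (C n).IsK (ι n) (k + n)) : Cov (tree hC) (T 0) where
  posMap := projMap hC 0
  stratMap _ σ := image σ 0
  stratMap_local _ _ _ _ h p hp := approx_local h (p.1.length + 1) 0 p hp
  lifting P σ x₀ h := by
    obtain ⟨x, hx, rfl⟩ := exists_isLiftSeq h
    by_cases hfin : ∃ n p, (x n).1 = .fin p
    · obtain ⟨n, p, hp⟩ := hfin
      obtain ⟨r, hr, hl⟩ := hx.exists_eq_fin hp p.length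
      exact hx.exists_lift_of_fin hr (by omega)
    · push Not at hfin
      obtain ⟨y, hy, hyx⟩ := hx.exists_lift_of_inf hfin
      exact ⟨y, hy, hyx ▸ FinInfSeq.Sub.refl _, Or.inl hyx⟩

/-- The composition of the first `n` of a sequence of embeddings. -/
def embed (ι : ∀ n, Y n ↪ Y (n + 1)) : ∀ n, Y 0 ↪ Y n
  | 0 => .refl _
  | n + 1 => (embed ι n).trans (ι n)

/-- The embedding of the letters of the first tree into those of the inverse limit. -/
def limitEmbedding (ι : ∀ n, Y n ↪ Y (n + 1)) : Y 0 ↪ ∀ n, Y n :=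
  ⟨fun a n => embed ι n a, fun _ _ h => congrFun h 0⟩

theorem map_limitEmbedding_proj (hC : ∀ n, (C n).IsK (ι n) (k + n)) {q : List (∀ n, Y n)}
    (hq : q ∈ (gameTree C).positions) (hk : q.length ≤ k) :
    (proj 0 q).map (limitEmbedding ι) = q := by
  have h : ∀ n, (proj 0 q).map (embed ι n) = proj n q := by
    intro n
    induction n with
    | zero => exact List.map_id _
    | succ n ih =>
      have h1 := (hC n).map_posMap ⟨_, proj_mem hq (n + 1)⟩ (by simp; omega)
      rw [posMap_proj hq] at h1
      refine Eq.trans ?_ h1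
      change _ = (proj n q).map (ι n)
      rw [← ih, List.map_map]
      rfl
  refine eq_of_proj_eq fun n => ?_
  rw [← h n]
  exact List.map_map

theorem isK_cov (hC : ∀ n, (C n).IsK (ι n) (k + n)) :
    (cov hC).IsK (limitEmbedding ι) k where
  map_posMap q hq := map_limitEmbedding_proj hC q.2 hq
  map_mem p hp hk := by
    obtain ⟨q, hq, rfl⟩ := exists_proj_eq hC hp hk
    rw [map_limitEmbedding_proj hC hq (by simpa using hk)]
    exact hq
  taboo_posMap P q hq hqt := by
    obtain ⟨n, hn⟩ := hqt.2
    induction n with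
    | zero => exact hn
    | succ n ih =>
      refine ih ?_
      have := (hC n).taboo_posMap P ⟨_, proj_mem q.2 (n + 1)⟩ (by simp; omega) hn
      rwa [posMap_proj q.2] at this
  follows P σ p a hp hf := by
    obtain ⟨q, z, rfl, rfl, hf'⟩ := image_follows (n := 0) hp hf
    have hk : q.length < k := by simpa using hp
    have := map_limitEmbedding_proj hC hf'.mem (by simp; omega)
    rw [proj_append, List.map_append] at this
    obtain ⟨h1, h2⟩ := List.append_inj' this rfl
    rw [h1]
    exact (List.singleton_inj.1 h2) ▸ hf'

end InverseLimit

/-! ### Borel sets are unravelable -/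

section Borel

variable {X : Type u}

theorem Unravelable.compl {T : TabooTree X} {k : ℕ} {A : Set T.Branch} (h : Unravelable T k A) :
    Unravelable T k Aᶜ := by
  obtain ⟨Y, T', C, ι, hC, hA⟩ := h
  exact ⟨Y, T', C, ι, hC, hA.compl⟩

/-- If a `k`-covering of `T` makes `A` unravelable, then `A` is unravelable. -/
theorem Unravelable.of_cov {Y : Type u} {T : TabooTree X} {T' : TabooTree Y} {k : ℕ}
    {A : Set T.Branch} {C : Cov T' T} {ι : X ↪ Y} (hC : C.IsK ι k)
    (h : Unravelable T' k (C.posMap.branchMap ⁻¹' A)) : Unravelable T k A := by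
  obtain ⟨Z, T'', D, κ, hD, hA⟩ := h
  refine ⟨Z, T'', C.comp D, ι.trans κ, hC.comp hD, ?_⟩
  convert hA using 1
  ext z
  exact iff_of_eq (congrArg (· ∈ A) (PositionMap.branchMap_comp _ _ z))

/-- A game tree with taboos together with a position map to `T`. -/
structure TreeOver (T : TabooTree X) where
  letters : Type u
  tree : TabooTree letters
  map : PositionMap tree T

/-- If the preimages of the sets `A n` in all trees over `T` are unravelable, then so is their
union: an inverse limit of coverings unraveling the sets one after the other makes all preimages
of the sets clopen, so that the preimage of the union is open. -/
theorem Unravelable.iUnion {T : TabooTree X} {k : ℕ} {A : ℕ → Set T.Branch}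
    (h : ∀ n (S : TreeOver T) (m : ℕ), Unravelable S.tree m (S.map.branchMap ⁻¹' A n)) :
    Unravelable T k (⋃ n, A n) := by
  choose L T' C ι hC hA using h
  let S : ℕ → TreeOver T := fun n => Nat.rec ⟨X, T, .id T⟩
    (fun n S => ⟨L n S (k + n), T' n S (k + n), S.map.comp (C n S (k + n)).posMap⟩) n
  let D : ∀ n, Cov (S (n + 1)).tree (S n).tree := fun n => C n (S n) (k + n)
  have hD : ∀ n, (D n).IsK (ι n (S n) (k + n)) (k + n) := fun n => hC n _ _
  have hK := InverseLimit.isK_cov (T := fun n => (S n).tree) hD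
  refine Unravelable.of_cov (T := (S 0).tree) hK (unravelable_of_isOpen _ k ?_)
  let π : ∀ n, PositionMap (InverseLimit.tree (T := fun n => (S n).tree) hD) (S n).tree :=
    InverseLimit.projMap (T := fun n => (S n).tree) hD
  have hproj : ∀ n y, (S n).map.branchMap ((π n).branchMap y) =
      (S 0).map.branchMap ((π 0).branchMap y) := by
    intro n y
    induction n with
    | zero => rfl
    | succ n ih =>
      have hn : (D n).posMap.comp (π (n + 1)) = π n :=
        InverseLimit.comp_projMap (T := fun n => (S n).tree) hD n
      rw [← ih, ← hn, PositionMap.branchMap_comp (D n).posMap (π (n + 1))]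
      exact PositionMap.branchMap_comp (S n).map (D n).posMap _
  have hpre : (π 0).branchMap ⁻¹' (⋃ n, A n) = ⋃ n, (π (n + 1)).branchMap ⁻¹'
      ((D n).posMap.branchMap ⁻¹' ((S n).map.branchMap ⁻¹' A n)) := by
    rw [Set.preimage_iUnion]
    refine Set.iUnion_congr fun n => Set.ext fun y => iff_of_eq (congrArg (· ∈ A n) ?_)
    have h1 := hproj (n + 1) y
    rw [show (S (n + 1)).map = (S n).map.comp (D n).posMap from rfl] at h1
    exact ((PositionMap.branchMap_id _).symm.trans h1.symm).trans
      (PositionMap.branchMap_comp _ _ _)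
  change IsOpen ((π 0).branchMap ⁻¹' (⋃ n, A n))
  rw [hpre]
  exact isOpen_iUnion fun n =>
    (hA n (S n) (k + n)).isOpen.preimage (π (n + 1)).continuous_branchMap

theorem unravelable_of_measurableSet {T : TabooTree X} {A : Set T.Branch}
    (hA : @MeasurableSet T.Branch (borel T.Branch) A) (S : TreeOver T) (k : ℕ) :
    Unravelable S.tree k (S.map.branchMap ⁻¹' A) := by
  change MeasurableSpace.GenerateMeasurable {s | IsOpen s} A at hA
  induction hA generalizing k S with
  | basic O hO => exact unravelable_of_isOpen _ k (hO.preimage S.map.continuous_branchMap)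
  | empty => exact unravelable_of_isOpen _ k isOpen_empty
  | compl A _ ih => exact (ih S k).compl
  | iUnion A _ ih =>
    rw [Set.preimage_iUnion]
    refine Unravelable.iUnion fun n S' m => ?_
    have := ih n ⟨S'.letters, S'.tree, S.map.comp S'.map⟩ m
    convert this using 1
    ext y
    exact (iff_of_eq (congrArg (· ∈ A n) (PositionMap.branchMap_comp S.map S'.map y))).symm

end Borel

theorem mainTheorem2 {X : Type u} (T : TabooTree X) (k : ℕ)
    (A : Set T.Branch) (hA : @MeasurableSet T.Branch (borel T.Branch) A) :
    ∃ (Y : Type u) (ι : X ↪ Y) (C : TabooCovering T Y),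
      C.IsKCovering ι k ∧ C.Unravels A := by
  obtain ⟨Y, T', C, ι, hC, hCA⟩ := unravelable_of_measurableSet hA ⟨X, T, .id T⟩ k
  refine ⟨Y, ι, C.toTabooCovering, hC.isKCovering, ?_⟩
  have : (PositionMap.id T).branchMap ⁻¹' A = A := by
    ext x
    exact iff_of_eq (congrArg (· ∈ A) (PositionMap.branchMap_id x))
  rwa [this] at hCA
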